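/- Let $N,M\ge 1$ and let $(F_\mu)_{\mu}$ be a family of probability distributions on $\mathbb R$. In the bipartite pair identification problem with (unknown) parameters $u\in(0,1)^N$, $v\in(0,1)^M$, in each round an algorithm chooses a row-column pair $(i,j)\in[N]\times[M]$, based on its past observations and possibly on internal randomness independent of the rewards, and observes a reward with distribution $F_{u_iv_j}$; all rewards are independent. At a stopping time $\tau_\delta\in\mathbb N\cup\{\infty\}$ (the number of samples used) it stops and returns a pair. Let $0<\delta<1/2$. The algorithm is $\delta$-PAC for $(F_\mu)$ if, for all $u\in(0,1)^N$, $v\in(0,1)^M$ for which the pair maximizing $u_iv_j$ is unique, with probability at least $1-\delta$ it stops after finitely many samples and returns that pair. Fix $u\in(0,1)^N$, $v\in(0,1)^M$ with $u_1\ge\dots\ge u_N$ and $v_1\ge\dots\ge v_M$. Write $\Delta^U_i=\max_{i'}u_{i'}-u_i$, $\Delta^V_j=\max_{j'}v_{j'}-v_j$, and $d(x,y)=x\log\frac xy+(1-x)\log\frac{1-x}{1-y}$, let $\mathbb E$ be the expectation when the parameters are $(u,v)$, and let $$A(u,v)=\sum_{i\in[N]:\,\Delta^U_i>0}\frac1{(v_1\Delta^U_i)^2}+\sum_{j\in[M]:\,\Delta^V_j>0}\frac1{(u_1\Delta^V_j)^2}.$$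 **(1)** Assume that * (monotonicity) for all $p,q\in[0,1]$ and $\kappa\ge1$ with $\kappa p,\kappa q\in[0,1]$, $\mathrm{D_{KL}}(F_p\|F_q)\le \mathrm{D_{KL}}(F_{\kappa p}\|F_{\kappa q})$; * (regularity) for all $0<p\le q<1$, $\limsup_{x\downarrow q}\mathrm{D_{KL}}(F_p\|F_x)\le \mathrm{D_{KL}}(F_p\|F_q)$ (this holds, for example, if $\mathrm{D_{KL}}$ is continuous in the second parameter). Then, for any algorithm that is $\delta$-PAC for $(F_\mu)$, $$\mathbb E[\tau_\delta]\ \ge\ A_F(u,v)\,d(\delta,1-\delta),$$ $$A_F(u,v)=\frac12\left(\sum_{i=2}^N\frac1{\mathrm{D_{KL}}(F_{u_iv_1}\|F_{(u_i+\Delta^U_i)v_1})}+\sum_{j=2}^M\frac1{\mathrm{D_{KL}}(F_{u_1v_j}\|F_{u_1(v_j+\Delta^V_j)})}\right),$$ with values in $[0,\infty]$ and $1/0=\infty$, $1/\infty=0$. **(2)** For rewards with normal distribution of unit variance, $F_\mu=\mathcal N(\mu,1)$, any $\delta$-PAC algorithm satisfies $\mathbb E[\tau_\delta]\ge A(u,v)\left(\log(1/\delta)-1\right)$.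 **(3)** For Bernoulli rewards, $F_\mu=\mathrm{Ber}(\mu)$, any $\delta$-PAC algorithm satisfies $$\mathbb E[\tau_\delta]\ \ge\ \frac{\min\{u_1v_1,\,1-u_1v_1\}}{4}\,A(u,v)\left(\log(1/\delta)-1\right).$$ -/

import Mathlib

open MeasureTheory ProbabilityTheory
open scoped ENNReal

noncomputable section

namespace PairBandit

/-- The record of the first `n` rounds: the sampled row-column pairs and the observed rewards. -/
abbrev Hist (N M n : ℕ) : Type := Fin n → (Fin N × Fin M) × ℝ

/-- A (possibly randomized) algorithm for best pair identification with `N` rows and `M` columns.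
Its internal randomness is a seed in `S`, drawn independently of the rewards. The choice of the
next pair, the decision to stop, and the returned pair at time `n` are measurable functions of the
seed and of the first `n` observations. -/
structure Algorithm (N M : ℕ) (S : Type*) [MeasurableSpace S] where
  /-- the distribution of the seed -/
  seedLaw : Measure S
  isProbabilityMeasure_seedLaw : IsProbabilityMeasure seedLaw
  /-- the pair sampled in round `n` (if the algorithm has not stopped) -/
  sample : ∀ n : ℕ, S × Hist N M n → Fin N × Fin M
  measurable_sample : ∀ n, Measurable (sample n)
  /-- the situations after `n` samples in which the algorithm stops (if it has not stopped yet) -/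
  stopSet : ∀ n : ℕ, Set (S × Hist N M n)
  measurableSet_stopSet : ∀ n, MeasurableSet (stopSet n)
  /-- the pair that is returned when stopping after `n` samples -/
  output : ∀ n : ℕ, S × Hist N M n → Fin N × Fin M
  measurable_output : ∀ n, Measurable (output n)

attribute [instance] Algorithm.isProbabilityMeasure_seedLaw

/-- A sample point: the seed, and the rewards `X_{t,(i,j)}` of all pairs in all rounds. -/
abbrev Outcome (N M : ℕ) (S : Type*) : Type _ := S × (ℕ → Fin N × Fin M → ℝ)

namespace Algorithm

variable {N M : ℕ} {S : Type*} [MeasurableSpace S]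

/-- The history of the first `n` rounds: in each round only the reward of the sampled pair is
recorded. -/
def hist (alg : Algorithm N M S) (ω : Outcome N M S) : ∀ n : ℕ, Hist N M n
  | 0 => Fin.elim0
  | n + 1 =>
    let h := alg.hist ω n
    let p := alg.sample n (ω.1, h)
    Fin.snoc (α := fun _ => (Fin N × Fin M) × ℝ) h (p, ω.2 n p)

/-- The number of samples `τ` used until the algorithm stops, `⊤` if it never stops. -/
def stopTime (alg : Algorithm N M S) (ω : Outcome N M S) : ℕ∞ :=
  ⨅ (n : ℕ) (_ : (ω.1, alg.hist ω n) ∈ alg.stopSet n), (n : ℕ∞)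

/-- The event that the algorithm stops after finitely many samples and returns the pair `p`. -/
def returns (alg : Algorithm N M S) (p : Fin N × Fin M) : Set (Outcome N M S) :=
  {ω | ∃ n : ℕ, alg.stopTime ω = n ∧ alg.output n (ω.1, alg.hist ω n) = p}

/-- The law of seed and rewards when the parameters are `u`, `v`: all rewards are independent of
each other and of the seed, and those of the pair `(i, j)` have the distribution
`F (u i * v j)`. -/
def law (alg : Algorithm N M S) (F : ℝ → Measure ℝ) [∀ μ, IsProbabilityMeasure (F μ)]
    (u : Fin N → ℝ) (v : Fin M → ℝ) : Measure (Outcome N M S) :=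
  alg.seedLaw.prod (Measure.infinitePi fun _ : ℕ =>
    Measure.pi fun p : Fin N × Fin M => F (u p.1 * v p.2))

/-- The expected number of samples `E[τ]`, in `[0, ∞]`. -/
def expectedSamples (alg : Algorithm N M S) (F : ℝ → Measure ℝ)
    [∀ μ, IsProbabilityMeasure (F μ)] (u : Fin N → ℝ) (v : Fin M → ℝ) : ℝ≥0∞ :=
  ∫⁻ ω, (alg.stopTime ω : ℝ≥0∞) ∂(alg.law F u v)

/-- `alg` is `δ`-PAC for the reward family `F`: for all parameters in `(0, 1)` for which the best
pair is unique, it stops and returns that pair with probability at least `1 - δ`. -/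
def IsPAC (alg : Algorithm N M S) (F : ℝ → Measure ℝ) [∀ μ, IsProbabilityMeasure (F μ)]
    (δ : ℝ) : Prop :=
  ∀ (u : Fin N → ℝ) (v : Fin M → ℝ),
    (∀ i, u i ∈ Set.Ioo 0 1) → (∀ j, v j ∈ Set.Ioo 0 1) →
    ∀ p : Fin N × Fin M, (∀ q, q ≠ p → u q.1 * v q.2 < u p.1 * v p.2) →
      ENNReal.ofReal (1 - δ) ≤ alg.law F u v (alg.returns p)

end Algorithm

/-- The gap `max_{i'} w i' - w i`. -/
def gap {n : ℕ} (w : Fin n → ℝ) (i : Fin n) : ℝ := (⨆ i', w i') - w i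

/-- The monotonicity of the Kullback-Leibler divergence under scaling of the parameters. -/
def KLMonotone (F : ℝ → Measure ℝ) : Prop :=
  ∀ p q κ : ℝ, p ∈ Set.Icc 0 1 → q ∈ Set.Icc 0 1 → 1 ≤ κ →
    κ * p ∈ Set.Icc 0 1 → κ * q ∈ Set.Icc 0 1 →
    InformationTheory.klDiv (F p) (F q) ≤ InformationTheory.klDiv (F (κ * p)) (F (κ * q))

/-- The Kullback-Leibler divergence does not jump upwards when its second parameter is slightly
increased: `limsup_{x ↓ q} KL(F p, F x) ≤ KL(F p, F q)` for `0 < p ≤ q < 1`. -/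
def KLUpperSemicontinuousRight (F : ℝ → Measure ℝ) : Prop :=
  ∀ p q : ℝ, 0 < p → p ≤ q → q < 1 →
    UpperSemicontinuousWithinAt (fun x => InformationTheory.klDiv (F p) (F x)) (Set.Ioi q) q

/-- The binary relative entropy `d(x, y)`. -/
def binRelEntropy (x y : ℝ) : ℝ :=
  x * Real.log (x / y) + (1 - x) * Real.log ((1 - x) / (1 - y))

/-- `A_F(u, v)`, in `[0, ∞]` with `1 / 0 = ∞` and `1 / ∞ = 0`; the index `0` is the first row
or column. -/
def rateKL {N M : ℕ} [NeZero N] [NeZero M] (F : ℝ → Measure ℝ) (u : Fin N → ℝ) (v : Fin M → ℝ) :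
    ℝ≥0∞ :=
  1 / 2 *
    ((∑ i : Fin N with i ≠ 0,
        1 / InformationTheory.klDiv (F (u i * v 0)) (F ((u i + gap u i) * v 0))) +
      ∑ j : Fin M with j ≠ 0,
        1 / InformationTheory.klDiv (F (u 0 * v j)) (F (u 0 * (v j + gap v j))))

/-- `A(u, v)`, with the sums over the rows and columns with positive gap. -/
def rate {N M : ℕ} [NeZero N] [NeZero M] (u : Fin N → ℝ) (v : Fin M → ℝ) : ℝ :=
  (∑ i : Fin N with 0 < gap u i, 1 / (v 0 * gap u i) ^ 2) +
    ∑ j : Fin M with 0 < gap v j, 1 / (u 0 * gap v j) ^ 2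

/-- Normal rewards with mean `μ` and unit variance. -/
def gaussianReward (μ : ℝ) : Measure ℝ := gaussianReal μ 1

instance (μ : ℝ) : IsProbabilityMeasure (gaussianReward μ) := by
  unfold gaussianReward; infer_instance

/-- Bernoulli rewards with mean `μ ∈ [0, 1]` (parameters outside `[0, 1]` do not occur; they are
projected to `[0, 1]`). -/
def bernoulliReward (μ : ℝ) : Measure ℝ :=
  bernoulliMeasure (1 : ℝ) 0 (Set.projIcc 0 1 zero_le_one μ)

instance (μ : ℝ) : IsProbabilityMeasure (bernoulliReward μ) := by
  unfold bernoulliReward; infer_instance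

end PairBandit

end

/-! The bound comes from confusing instances. If `(0, 0)` is the unique best pair, raise `u i` for
one row `i ≠ 0` until the pair `(i, 0)` has parameter `x` slightly above `u 0 * v 0`. Then `(i, 0)`
is the unique best pair, so it is returned with probability at least `1 - δ`, against at most `δ`
before, while only the rewards of row `i` have changed. The change-of-measure inequality
`binRelEntropy_le_sum_expectedPulls_mul_klDiv` turns this into a lower bound on the samples in row
`i`, weighted by their divergences. Monotonicity bounds all these divergences by the one in column
`0`, and semicontinuity lets `x` decrease to `u 0 * v 0`. The rows are disjoint, so the row bounds
add up to at most `E[τ]`; so do the column bounds, and the average of the two is the claim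
(`IsPAC.rateKL_mul_le_expectedSamples`).

If the best pair is not unique, being PAC says nothing at `(u, v)` itself, and the claim holds
because `E[τ] = ∞`: one of two tied pairs is returned with probability at most `1/2`, although an
arbitrarily small perturbation makes it the unique best pair (`IsPAC.expectedSamples_eq_top`).

Since `τ` may be infinite, the change of measure is carried out at a finite horizon `n`, by a
variational inequality for a two-valued function of the returned pair, and then `n → ∞`.

For Gaussian and Bernoulli rewards it remains to bound the divergence by a multiple of the squared
gap, and `d(δ, 1 - δ)` from below by `log (1 / δ) - 1`. -/

noncomputable section

namespace PairBandit

/-! ### Histories, and the independence of fresh rewards from the past -/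

namespace Algorithm

variable {N M : ℕ} {S : Type*}

/-- Extend a seed and a history by one further observation. -/
def extend (n : ℕ) (x : S × Hist N M n) (p : Fin N × Fin M) (y : ℝ) : S × Hist N M (n + 1) :=
  (x.1, Fin.snoc (α := fun _ => (Fin N × Fin M) × ℝ) x.2 (p, y))

/-- The sum of `ℓ` over the observations in a history. -/
def histSum (ℓ : Fin N × Fin M → ℝ → ℝ) (n : ℕ) (x : S × Hist N M n) : ℝ :=
  ∑ t : Fin n, ℓ (x.2 t).1 (x.2 t).2

lemma histSum_extend (ℓ : Fin N × Fin M → ℝ → ℝ) (n : ℕ) (x : S × Hist N M n)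
    (p : Fin N × Fin M) (y : ℝ) :
    histSum ℓ (n + 1) (extend n x p y) = histSum ℓ n x + ℓ p y := by
  simp [histSum, extend, Fin.sum_univ_castSucc]

variable [MeasurableSpace S]

lemma measurable_apply_of_finite {Ω ι : Type*} [MeasurableSpace Ω] [MeasurableSpace ι]
    [Countable ι] [MeasurableSingletonClass ι] {X : Ω → ι → ℝ} {I : Ω → ι}
    (hX : Measurable X) (hI : Measurable I) : Measurable fun ω => X ω (I ω) := by
  have h : Measurable fun q : (ι → ℝ) × ι => q.1 q.2 :=
    measurable_from_prod_countable_left fun i => measurable_pi_apply i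
  exact h.comp (hX.prodMk hI)

/-- The seed together with the history of the first `n` rounds. -/
def obs (alg : Algorithm N M S) (n : ℕ) (ω : Outcome N M S) : S × Hist N M n :=
  (ω.1, alg.hist ω n)

/-- The pair sampled in round `n`. -/
def chosen (alg : Algorithm N M S) (n : ℕ) (ω : Outcome N M S) : Fin N × Fin M :=
  alg.sample n (alg.obs n ω)

lemma obs_succ (alg : Algorithm N M S) (n : ℕ) (ω : Outcome N M S) :
    alg.obs (n + 1) ω = extend n (alg.obs n ω) (alg.chosen n ω) (ω.2 n (alg.chosen n ω)) := rfl

lemma measurable_extend (n : ℕ) :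
    Measurable fun q : (S × Hist N M n) × (Fin N × Fin M) × ℝ => extend n q.1 q.2.1 q.2.2 := by
  refine Measurable.prodMk (by fun_prop) (measurable_pi_lambda _ fun i => ?_)
  refine Fin.lastCases ?_ (fun i => ?_) i
  · simp only [Fin.snoc_last]; fun_prop
  · simp only [Fin.snoc_castSucc]; fun_prop

lemma measurable_obs (alg : Algorithm N M S) (n : ℕ) : Measurable (alg.obs n) := by
  induction n with
  | zero =>
    exact measurable_fst.prodMk (measurable_pi_lambda _ fun i => i.elim0)
  | succ n ih =>
    have hc : Measurable (alg.chosen n) := (alg.measurable_sample n).comp ih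
    have hX : Measurable fun ω : Outcome N M S => ω.2 n (alg.chosen n ω) :=
      measurable_apply_of_finite (by fun_prop) hc
    exact (measurable_extend n).comp (ih.prodMk (hc.prodMk hX))

lemma hist_congr (alg : Algorithm N M S) (s : S) {X Y : ℕ → Fin N × Fin M → ℝ} (n : ℕ)
    (h : ∀ t < n, X t = Y t) : alg.hist (s, X) n = alg.hist (s, Y) n := by
  induction n with
  | zero => rfl
  | succ n ih =>
    have h1 := ih fun t ht => h t (ht.trans (Nat.lt_succ_self n))
    simp only [hist, h1, h n (Nat.lt_succ_self n)]

/-- The law of seed and rewards when the rewards of the pair `p` have the distribution `ν p`. -/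
def pairLaw (alg : Algorithm N M S) (ν : Fin N × Fin M → Measure ℝ)
    [∀ p, IsProbabilityMeasure (ν p)] : Measure (Outcome N M S) :=
  alg.seedLaw.prod (Measure.infinitePi fun _ : ℕ => Measure.pi ν)

instance (alg : Algorithm N M S) (ν : Fin N × Fin M → Measure ℝ)
    [∀ p, IsProbabilityMeasure (ν p)] : IsProbabilityMeasure (alg.pairLaw ν) := by
  unfold pairLaw; infer_instance

section

variable (alg : Algorithm N M S) (ν : Fin N × Fin M → Measure ℝ) [∀ p, IsProbabilityMeasure (ν p)]

/-- For a fixed seed, the history is a function of the rewards in rounds before `n` only. -/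
lemma indepFun_hist (s : S) (n : ℕ) :
    IndepFun (fun X => alg.hist (s, X) n) (fun X : ℕ → Fin N × Fin M → ℝ => X n)
      (Measure.infinitePi fun _ : ℕ => Measure.pi ν) := by
  have hi : iIndepFun (fun (t : ℕ) (X : ℕ → Fin N × Fin M → ℝ) => X t)
      (Measure.infinitePi fun _ : ℕ => Measure.pi ν) :=
    iIndepFun_infinitePi (X := fun _ x => x) (fun _ => measurable_id)
  have h2 := hi.indepFun_finset (Finset.range n) {n} (by simp) (fun i => measurable_pi_apply i)
  -- Padding with zeros shows the history as a function of finitely many rounds; by `hist_congr` the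
  -- padding is never read.
  let ext : ((t : Finset.range n) → Fin N × Fin M → ℝ) → ℕ → Fin N × Fin M → ℝ :=
    fun y t => if h : t ∈ Finset.range n then y ⟨t, h⟩ else 0
  have hext : Measurable ext := measurable_pi_lambda _ fun t => by
    by_cases h : t ∈ Finset.range n
    · simp only [ext, h, dite_true]; exact measurable_pi_apply _
    · simp only [ext, h, dite_false]; exact measurable_const
  have hmh : Measurable fun X => alg.hist (s, X) n :=
    (measurable_snd.comp (alg.measurable_obs n)).comp measurable_prodMk_left
  have hev : Measurable fun y : ((t : ({n} : Finset ℕ)) → Fin N × Fin M → ℝ) =>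
      y ⟨n, Finset.mem_singleton_self n⟩ := measurable_pi_apply _
  have h3 := h2.comp (φ := fun y => alg.hist (s, ext y) n)
    (ψ := fun y => y ⟨n, Finset.mem_singleton_self n⟩) (hmh.comp hext) hev
  convert h3 using 1
  · funext X
    refine alg.hist_congr s n fun t ht => ?_
    simp [ext, ht]
  · rfl

lemma lintegral_pairLaw {g : Outcome N M S → ℝ≥0∞} (hg : Measurable g) :
    ∫⁻ ω, g ω ∂(alg.pairLaw ν) =
      ∫⁻ s, ∫⁻ X, g (s, X) ∂(Measure.infinitePi fun _ : ℕ => Measure.pi ν) ∂alg.seedLaw :=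
  lintegral_prod _ hg.aemeasurable

lemma map_obs_prod_reward (n : ℕ) :
    (alg.pairLaw ν).map (fun ω => (alg.obs n ω, ω.2 n)) =
      ((alg.pairLaw ν).map (alg.obs n)).prod (Measure.pi ν) := by
  have hm := alg.measurable_obs n
  have hmr : Measurable fun ω : Outcome N M S => ω.2 n := by fun_prop
  have : IsProbabilityMeasure ((alg.pairLaw ν).map (alg.obs n)) :=
    Measure.isProbabilityMeasure_map hm.aemeasurable
  refine Measure.ext_of_lintegral _ fun φ hφ => ?_
  rw [lintegral_map hφ (hm.prodMk hmr), lintegral_prod _ hφ.aemeasurable,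
    lintegral_map hφ.lintegral_prod_right' hm,
    alg.lintegral_pairLaw ν (g := fun ω => φ (alg.obs n ω, ω.2 n)) (hφ.comp (hm.prodMk hmr)),
    alg.lintegral_pairLaw ν (g := fun ω => ∫⁻ y, φ (alg.obs n ω, y) ∂Measure.pi ν)
      (hφ.lintegral_prod_right'.comp hm)]
  refine lintegral_congr fun s => ?_
  have hmh : Measurable fun X => alg.hist (s, X) n :=
    (measurable_snd.comp hm).comp measurable_prodMk_left
  have hi := (alg.indepFun_hist ν s n).map_prod_eq_prod_map_map hmh.aemeasurable
    (measurable_pi_apply n).aemeasurable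
  rw [Measure.infinitePi_map_eval] at hi
  have : IsProbabilityMeasure ((Measure.infinitePi fun _ : ℕ => Measure.pi ν).map
      fun X => alg.hist (s, X) n) := Measure.isProbabilityMeasure_map hmh.aemeasurable
  have hφs : Measurable fun q : Hist N M n × (Fin N × Fin M → ℝ) => φ ((s, q.1), q.2) :=
    hφ.comp (by fun_prop)
  have e := lintegral_map (μ := Measure.infinitePi fun _ : ℕ => Measure.pi ν) hφs
    (hmh.prodMk (measurable_pi_apply n))
  rw [hi, lintegral_prod _ hφs.aemeasurable, lintegral_map hφs.lintegral_prod_right' hmh] at e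
  exact e.symm

lemma map_reward (n : ℕ) : (alg.pairLaw ν).map (fun ω => ω.2 n) = Measure.pi ν := by
  have h := congrArg (Measure.map Prod.snd) (alg.map_obs_prod_reward ν n)
  have hm := alg.measurable_obs n
  have : IsProbabilityMeasure ((alg.pairLaw ν).map (alg.obs n)) :=
    Measure.isProbabilityMeasure_map hm.aemeasurable
  rw [Measure.map_map measurable_snd (hm.prodMk (by fun_prop))] at h
  simpa [Function.comp_def] using h

lemma indepFun_obs_reward (n : ℕ) :
    IndepFun (alg.obs n) (fun ω : Outcome N M S => ω.2 n) (alg.pairLaw ν) := by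
  rw [indepFun_iff_map_prod_eq_prod_map_map (alg.measurable_obs n).aemeasurable
    (by fun_prop), alg.map_obs_prod_reward, alg.map_reward]

lemma map_reward_apply (n : ℕ) (p : Fin N × Fin M) :
    (alg.pairLaw ν).map (fun ω => ω.2 n p) = ν p := by
  rw [← (measurePreserving_eval ν p).map_eq, ← alg.map_reward ν n,
    Measure.map_map (measurable_pi_apply p) (by fun_prop)]
  rfl

/-- The pair to be sampled is a function of the past, and the rewards of round `n` are independent
of the past. Given the past, the observed reward therefore has the law of the chosen pair. -/
lemma lintegral_next (n : ℕ) {Ψ : S × Hist N M n → ℝ → ℝ≥0∞}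
    (hΨ : Measurable (Function.uncurry Ψ)) :
    ∫⁻ ω, Ψ (alg.obs n ω) (ω.2 n (alg.chosen n ω)) ∂(alg.pairLaw ν) =
      ∫⁻ ω, ∫⁻ x, Ψ (alg.obs n ω) x ∂(ν (alg.chosen n ω)) ∂(alg.pairLaw ν) := by
  have hm := alg.measurable_obs n
  have hmr : Measurable fun ω : Outcome N M S => ω.2 n := by fun_prop
  have : IsProbabilityMeasure ((alg.pairLaw ν).map (alg.obs n)) :=
    Measure.isProbabilityMeasure_map hm.aemeasurable
  let φ : (S × Hist N M n) × (Fin N × Fin M → ℝ) → ℝ≥0∞ :=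
    fun q => Ψ q.1 (q.2 (alg.sample n q.1))
  have hφ : Measurable φ := hΨ.comp (measurable_fst.prodMk
    (measurable_apply_of_finite measurable_snd ((alg.measurable_sample n).comp measurable_fst)))
  have e := lintegral_map (μ := alg.pairLaw ν) hφ (hm.prodMk hmr)
  rw [alg.map_obs_prod_reward, lintegral_prod _ hφ.aemeasurable,
    lintegral_map hφ.lintegral_prod_right' hm] at e
  refine e.symm.trans (lintegral_congr fun ω => ?_)
  exact (measurePreserving_eval ν (alg.chosen n ω)).lintegral_comp
    (f := Ψ (alg.obs n ω)) (hΨ.comp measurable_prodMk_left)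

end

/-! ### Change of measure at a fixed time -/

lemma measurable_uncurry_of_finite {ℓ : Fin N × Fin M → ℝ → ℝ} (hℓ : ∀ p, Measurable (ℓ p)) :
    Measurable fun q : (Fin N × Fin M) × ℝ => ℓ q.1 q.2 :=
  measurable_from_prod_countable_right hℓ

lemma measurable_histSum {ℓ : Fin N × Fin M → ℝ → ℝ} (hℓ : ∀ p, Measurable (ℓ p)) (n : ℕ) :
    Measurable (histSum (S := S) ℓ n) :=
  Finset.measurable_sum _ fun t _ =>
    (measurable_uncurry_of_finite hℓ).comp ((measurable_pi_apply t).comp measurable_snd)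

lemma histSum_obs (alg : Algorithm N M S) (ℓ : Fin N × Fin M → ℝ → ℝ) (n : ℕ)
    (ω : Outcome N M S) :
    histSum ℓ n (alg.obs n ω) =
      ∑ t ∈ Finset.range n, ℓ (alg.chosen t ω) (ω.2 t (alg.chosen t ω)) := by
  induction n with
  | zero => simp [histSum]
  | succ n ih => rw [obs_succ, histSum_extend, ih, Finset.sum_range_succ]

/-- Change of measure: weighting by `exp (-ℓ)` in each round dominates one law by the other. -/
lemma lintegral_exp_neg_histSum_mul_le (alg : Algorithm N M S)
    (ν ν' : Fin N × Fin M → Measure ℝ) [∀ p, IsProbabilityMeasure (ν p)]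
    [∀ p, IsProbabilityMeasure (ν' p)] {ℓ : Fin N × Fin M → ℝ → ℝ} (hℓ : ∀ p, Measurable (ℓ p))
    (hle : ∀ p (φ : ℝ → ℝ≥0∞), Measurable φ →
      ∫⁻ x, ENNReal.ofReal (Real.exp (-ℓ p x)) * φ x ∂(ν p) ≤ ∫⁻ x, φ x ∂(ν' p))
    (n : ℕ) {φ : S × Hist N M n → ℝ≥0∞} (hφ : Measurable φ) :
    ∫⁻ ω, ENNReal.ofReal (Real.exp (-histSum ℓ n (alg.obs n ω))) * φ (alg.obs n ω)
        ∂(alg.pairLaw ν) ≤ ∫⁻ ω, φ (alg.obs n ω) ∂(alg.pairLaw ν') := by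
  induction n with
  | zero =>
    -- Before the first round only the seed is known, and its law does not depend on the rewards.
    have h0 : ∀ ω : Outcome N M S, alg.obs 0 ω = (ω.1, Fin.elim0) := fun ω => rfl
    have hφ0 : Measurable fun s : S => φ (s, Fin.elim0) := hφ.comp measurable_prodMk_right
    have key : ∀ (κ : Fin N × Fin M → Measure ℝ) [∀ p, IsProbabilityMeasure (κ p)],
        ∫⁻ ω, φ (alg.obs 0 ω) ∂(alg.pairLaw κ) = ∫⁻ s, φ (s, Fin.elim0) ∂alg.seedLaw := by
      intro κ _
      simp only [h0]
      rw [alg.lintegral_pairLaw κ (g := fun ω => φ (ω.1, Fin.elim0)) (hφ0.comp measurable_fst)]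
      simp
    simp only [histSum, Finset.univ_eq_empty, Finset.sum_empty, neg_zero, Real.exp_zero,
      ENNReal.ofReal_one, one_mul]
    rw [key, key]
  | succ n ih =>
    have hext : Measurable fun q : (S × Hist N M n) × ℝ =>
        extend n q.1 (alg.sample n q.1) q.2 :=
      (measurable_extend n).comp (measurable_fst.prodMk
        (((alg.measurable_sample n).comp measurable_fst).prodMk measurable_snd))
    have hφe : Measurable fun q : (S × Hist N M n) × ℝ =>
        φ (extend n q.1 (alg.sample n q.1) q.2) := hφ.comp hext
    have hstep : Measurable fun q : (S × Hist N M n) × ℝ => ENNReal.ofReal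
        (Real.exp (-histSum ℓ (n + 1) (extend n q.1 (alg.sample n q.1) q.2))) :=
      ((measurable_histSum hℓ (n + 1)).comp hext).neg.exp.ennreal_ofReal
    have e1 := alg.lintegral_next ν n (Ψ := fun x y => ENNReal.ofReal
        (Real.exp (-histSum ℓ (n + 1) (extend n x (alg.sample n x) y))) *
          φ (extend n x (alg.sample n x) y)) (hstep.mul hφe)
    have e2 := alg.lintegral_next ν' n (Ψ := fun x y => φ (extend n x (alg.sample n x) y)) hφe
    have hin : Measurable fun x : S × Hist N M n =>
        ∫⁻ y, φ (extend n x (alg.sample n x) y) ∂(ν' (alg.sample n x)) := by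
      have hp : ∀ p, Measurable fun x : S × Hist N M n =>
          ∫⁻ y, φ (extend n x (alg.sample n x) y) ∂(ν' p) := fun p =>
        hφe.lintegral_prod_right'
      exact (measurable_from_prod_countable_left (f := fun q : (S × Hist N M n) × _ =>
        ∫⁻ y, φ (extend n q.1 (alg.sample n q.1) y) ∂(ν' q.2)) hp).comp
        (measurable_id.prodMk (alg.measurable_sample n))
    have e3 := ih hin
    refine (e1.le.trans ?_).trans (e3.trans e2.symm.le)
    refine lintegral_mono fun ω => ?_
    have hy : Measurable fun y => φ (extend n (alg.obs n ω) (alg.chosen n ω) y) :=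
      hφe.comp (measurable_prodMk_left (x := alg.obs n ω))
    have hprod : Measurable fun y => ENNReal.ofReal (Real.exp (-ℓ (alg.chosen n ω) y)) *
        φ (extend n (alg.obs n ω) (alg.chosen n ω) y) :=
      Measurable.mul ((hℓ _).neg.exp.ennreal_ofReal) hy
    calc ∫⁻ y, ENNReal.ofReal (Real.exp
            (-histSum ℓ (n + 1) (extend n (alg.obs n ω) (alg.chosen n ω) y))) *
          φ (extend n (alg.obs n ω) (alg.chosen n ω) y) ∂(ν (alg.chosen n ω))
        = ENNReal.ofReal (Real.exp (-histSum ℓ n (alg.obs n ω))) *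
            ∫⁻ y, ENNReal.ofReal (Real.exp (-ℓ (alg.chosen n ω) y)) *
              φ (extend n (alg.obs n ω) (alg.chosen n ω) y) ∂(ν (alg.chosen n ω)) := by
          rw [← lintegral_const_mul _ hprod]
          refine lintegral_congr fun y => ?_
          rw [histSum_extend, neg_add, Real.exp_add, ENNReal.ofReal_mul (Real.exp_pos _).le,
            mul_assoc]
      _ ≤ _ := mul_le_mul_right (hle _ _ hy) _

/-! ### Stopping, returning, and counting samples -/

section Stopping

variable (alg : Algorithm N M S)

lemma natCast_le_stopTime_iff {n : ℕ} {ω : Outcome N M S} :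
    (n : ℕ∞) ≤ alg.stopTime ω ↔ ∀ k < n, alg.obs k ω ∉ alg.stopSet k := by
  unfold stopTime
  rw [le_iInf₂_iff]
  constructor
  · intro h k hk hs
    exact absurd (Nat.cast_le.mp (h k hs)) (not_le.mpr hk)
  · intro h k hs
    by_contra hlt
    exact h k (Nat.cast_lt.mp (not_le.mp hlt)) hs

lemma natCast_lt_stopTime_iff {n : ℕ} {ω : Outcome N M S} :
    (n : ℕ∞) < alg.stopTime ω ↔ (n : ℕ∞) ≤ alg.stopTime ω ∧ alg.obs n ω ∉ alg.stopSet n := by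
  rw [← ENat.add_one_le_iff (ENat.natCast_ne_top n), ← Nat.cast_one, ← Nat.cast_add,
    natCast_le_stopTime_iff, natCast_le_stopTime_iff]
  exact ⟨fun h => ⟨fun k hk => h k (hk.trans (Nat.lt_succ_self n)), h n (Nat.lt_succ_self n)⟩,
    fun h k hk => (Nat.lt_succ_iff_lt_or_eq.mp hk).elim (h.1 k) fun e => e ▸ h.2⟩

lemma stopTime_eq_iff {n : ℕ} {ω : Outcome N M S} :
    alg.stopTime ω = n ↔ (n : ℕ∞) ≤ alg.stopTime ω ∧ alg.obs n ω ∈ alg.stopSet n := by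
  have h := alg.natCast_lt_stopTime_iff (n := n) (ω := ω)
  constructor
  · intro heq
    refine ⟨heq.ge, by_contra fun hs => ?_⟩
    exact absurd (h.mpr ⟨heq.ge, hs⟩) (by simp [heq])
  · rintro ⟨hle, hs⟩
    by_contra hne
    exact (h.mp (lt_of_le_of_ne hle (Ne.symm hne))).2 hs

/-- The first `k` rounds of a history of length `n`. -/
def truncate {n k : ℕ} (h : k ≤ n) (x : S × Hist N M n) : S × Hist N M k :=
  (x.1, fun i => x.2 (Fin.castLE h i))

lemma truncate_obs {n k : ℕ} (h : k ≤ n) (ω : Outcome N M S) :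
    truncate h (alg.obs n ω) = alg.obs k ω := by
  induction n with
  | zero => obtain rfl := Nat.le_zero.mp h; rfl
  | succ n ih =>
    rcases Nat.lt_or_eq_of_le h with hlt | rfl
    · rw [← ih (Nat.lt_succ_iff.mp hlt), obs_succ]
      refine Prod.ext rfl (funext fun i => ?_)
      have e : Fin.castLE h i = (Fin.castLE (Nat.lt_succ_iff.mp hlt) i).castSucc := rfl
      simp only [truncate, extend, e, Fin.snoc_castSucc]
    · rfl

lemma measurable_truncate {n k : ℕ} (h : k ≤ n) :
    Measurable (truncate (S := S) (N := N) (M := M) h) := by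
  unfold truncate; fun_prop

/-- The situations after `n` samples that the algorithm reaches without stopping earlier. -/
def reachSet (n : ℕ) : Set (S × Hist N M n) :=
  {x | ∀ k, ∀ h : k < n, truncate h.le x ∉ alg.stopSet k}

lemma measurableSet_reachSet (n : ℕ) : MeasurableSet (alg.reachSet n) := by
  have : alg.reachSet n = ⋂ k, ⋂ h : k < n, (truncate h.le ⁻¹' alg.stopSet k)ᶜ := by
    ext x; simp [reachSet]
  rw [this]
  exact MeasurableSet.iInter fun k => MeasurableSet.iInter fun h =>
    (measurable_truncate h.le (alg.measurableSet_stopSet k)).compl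

lemma obs_mem_reachSet_iff {n : ℕ} {ω : Outcome N M S} :
    alg.obs n ω ∈ alg.reachSet n ↔ (n : ℕ∞) ≤ alg.stopTime ω := by
  simp [reachSet, truncate_obs, natCast_le_stopTime_iff]

/-- The event that the pair `p` is sampled in round `n`. -/
def pullEvent (p : Fin N × Fin M) (n : ℕ) : Set (Outcome N M S) :=
  {ω | (n : ℕ∞) < alg.stopTime ω ∧ alg.chosen n ω = p}

/-- The set of observations with which the pair `p` is sampled in round `n`. -/
def pullSet (p : Fin N × Fin M) (n : ℕ) : Set (S × Hist N M n) :=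
  (alg.reachSet n ∩ (alg.stopSet n)ᶜ) ∩ alg.sample n ⁻¹' {p}

lemma measurableSet_pullSet (p : Fin N × Fin M) (n : ℕ) : MeasurableSet (alg.pullSet p n) :=
  ((alg.measurableSet_reachSet n).inter (alg.measurableSet_stopSet n).compl).inter
    (alg.measurable_sample n (measurableSet_singleton p))

/-- Whether `p` is sampled in round `n` is decided before the rewards of that round are drawn; this
predictability is what Wald's identity needs. -/
lemma pullEvent_eq (p : Fin N × Fin M) (n : ℕ) :
    alg.pullEvent p n = alg.obs n ⁻¹' alg.pullSet p n := by
  ext ω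
  simp [pullEvent, pullSet, natCast_lt_stopTime_iff, obs_mem_reachSet_iff, chosen]

lemma measurableSet_pullEvent (p : Fin N × Fin M) (n : ℕ) :
    MeasurableSet (alg.pullEvent p n) := by
  rw [pullEvent_eq]; exact alg.measurable_obs n (alg.measurableSet_pullSet p n)

/-- The event that the algorithm stops before time `n` and returns the pair `p`. -/
def returnsBefore (n : ℕ) (p : Fin N × Fin M) : Set (Outcome N M S) :=
  {ω | ∃ k < n, alg.stopTime ω = k ∧ alg.output k (alg.obs k ω) = p}

lemma measurableSet_returnsBefore (n : ℕ) (p : Fin N × Fin M) :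
    MeasurableSet (alg.returnsBefore n p) := by
  have : alg.returnsBefore n p = ⋃ k, ⋃ _ : k < n,
      alg.obs k ⁻¹' ((alg.reachSet k ∩ alg.stopSet k) ∩ alg.output k ⁻¹' {p}) := by
    ext ω
    simp only [returnsBefore, stopTime_eq_iff, Set.mem_ofPred_eq, Set.mem_iUnion, Set.mem_preimage,
      Set.mem_inter_iff, obs_mem_reachSet_iff, Set.mem_singleton_iff, exists_prop]
  rw [this]
  exact MeasurableSet.iUnion fun k => MeasurableSet.iUnion fun _ => alg.measurable_obs k
    (((alg.measurableSet_reachSet k).inter (alg.measurableSet_stopSet k)).inter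
      (alg.measurable_output k (measurableSet_singleton p)))

lemma monotone_returnsBefore (p : Fin N × Fin M) :
    Monotone fun n => alg.returnsBefore n p :=
  fun _ _ hmn _ ⟨k, hk, h⟩ => ⟨k, hk.trans_le hmn, h⟩

lemma iUnion_returnsBefore (p : Fin N × Fin M) :
    ⋃ n, alg.returnsBefore n p = alg.returns p := by
  ext ω
  simp only [Set.mem_iUnion, returnsBefore, returns, Set.mem_ofPred_eq]
  exact ⟨fun ⟨_, k, _, h⟩ => ⟨k, h⟩, fun ⟨k, h⟩ => ⟨k + 1, k, Nat.lt_succ_self k, h⟩⟩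

lemma measurableSet_returns (p : Fin N × Fin M) : MeasurableSet (alg.returns p) := by
  rw [← iUnion_returnsBefore]
  exact MeasurableSet.iUnion fun n => alg.measurableSet_returnsBefore n p

lemma disjoint_returns {p q : Fin N × Fin M} (hpq : p ≠ q) :
    Disjoint (alg.returns p) (alg.returns q) := by
  rw [Set.disjoint_left]
  rintro ω ⟨m, hm, hp⟩ ⟨n, hn, hq⟩
  obtain rfl : m = n := by exact_mod_cast hm.symm.trans hn
  exact hpq (hp.symm.trans hq)

lemma tendsto_measureReal_returnsBefore (μ : Measure (Outcome N M S)) [IsFiniteMeasure μ]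
    (p : Fin N × Fin M) :
    Filter.Tendsto (fun n => μ.real (alg.returnsBefore n p)) Filter.atTop
      (nhds (μ.real (alg.returns p))) := by
  have h := tendsto_measure_iUnion_atTop (μ := μ) (alg.monotone_returnsBefore p)
  rw [iUnion_returnsBefore] at h
  exact (ENNReal.tendsto_toReal (measure_ne_top μ _)).comp h

/-- The expected number of times that the pair `p` is sampled. -/
def expectedPulls (ν : Fin N × Fin M → Measure ℝ) [∀ p, IsProbabilityMeasure (ν p)]
    (p : Fin N × Fin M) : ℝ≥0∞ :=
  ∑' n : ℕ, alg.pairLaw ν (alg.pullEvent p n)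

lemma sum_expectedPulls_le (ν : Fin N × Fin M → Measure ℝ) [∀ p, IsProbabilityMeasure (ν p)] :
    ∑ p, alg.expectedPulls ν p ≤ ∫⁻ ω, (alg.stopTime ω : ℝ≥0∞) ∂(alg.pairLaw ν) := by
  have hm : ∀ n p, Measurable ((alg.pullEvent p n).indicator (1 : Outcome N M S → ℝ≥0∞)) :=
    fun n p => measurable_one.indicator (alg.measurableSet_pullEvent p n)
  have e : ∑ p, alg.expectedPulls ν p =
      ∫⁻ ω, ∑' n, ∑ p, (alg.pullEvent p n).indicator 1 ω ∂(alg.pairLaw ν) := by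
    rw [lintegral_tsum fun n => (Finset.measurable_sum _ fun p _ => hm n p).aemeasurable]
    unfold expectedPulls
    rw [← (Summable.tsum_finsetSum fun _ _ => ENNReal.summable)]
    refine tsum_congr fun n => ?_
    rw [lintegral_finsetSum _ fun p _ => hm n p]
    refine Finset.sum_congr rfl fun p _ => ?_
    rw [lintegral_indicator_one (alg.measurableSet_pullEvent p n)]
  rw [e]
  refine lintegral_mono fun ω => ?_
  refine ENNReal.tsum_le_of_sum_range_le fun n => ?_
  have h1 : ∀ k, ∑ p, (alg.pullEvent p k).indicator (1 : Outcome N M S → ℝ≥0∞) ω =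
      if (k : ℕ∞) < alg.stopTime ω then 1 else 0 := by
    intro k
    by_cases hk : (k : ℕ∞) < alg.stopTime ω
    · simp [Set.indicator_apply, pullEvent, hk]
    · simp [pullEvent, hk]
  simp only [h1]
  induction h : alg.stopTime ω using ENat.recTopCoe with
  | top => simp
  | coe m =>
    simp only [Nat.cast_lt, ENat.toENNReal_coe]
    rw [Finset.sum_ite, Finset.sum_const_zero, add_zero, Finset.sum_const, nsmul_one, Nat.cast_le]
    refine (Finset.card_le_card (t := Finset.range m) fun k hk => ?_).trans
      (Finset.card_range m).le
    simpa using (Finset.mem_filter.mp hk).2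

end Stopping

/-! ### Change of measure up to stopping -/

section ChangeOfMeasure

variable (alg : Algorithm N M S)

/-- The sum of `ℓ` over the observations in the rounds before time `n` and before stopping. -/
def stoppedSum (ℓ : Fin N × Fin M → ℝ → ℝ) (n : ℕ) (ω : Outcome N M S) : ℝ :=
  ∑ t ∈ Finset.range n, ∑ p, (alg.pullEvent p t).indicator 1 ω * ℓ p (ω.2 t p)

open Classical in
/-- The function with the value `α` if `p` is returned before time `n`, and `β` otherwise. -/
def returnWeight (n : ℕ) (p : Fin N × Fin M) (α β : ℝ) (ω : Outcome N M S) : ℝ :=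
  if ω ∈ alg.returnsBefore n p then α else β

/-- The part of `returnWeight` on the event that the algorithm stops at time `k`. -/
def stopWeight (p : Fin N × Fin M) (α β : ℝ) (k : ℕ) : S × Hist N M k → ℝ≥0∞ :=
  (alg.reachSet k ∩ alg.stopSet k).indicator
    fun x => ENNReal.ofReal (Real.exp (if alg.output k x = p then α else β))

/-- The part of `returnWeight` on the event that the algorithm does not stop before time `n`. -/
def reachWeight (β : ℝ) (n : ℕ) : S × Hist N M n → ℝ≥0∞ :=
  (alg.reachSet n).indicator fun _ => ENNReal.ofReal (Real.exp β)

lemma measurable_stopWeight (p : Fin N × Fin M) (α β : ℝ) (k : ℕ) :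
    Measurable (alg.stopWeight p α β k) := by
  refine Measurable.indicator ?_
    ((alg.measurableSet_reachSet k).inter (alg.measurableSet_stopSet k))
  exact (Measurable.ite (alg.measurable_output k (measurableSet_singleton p)) measurable_const
    measurable_const).exp.ennreal_ofReal

lemma measurable_reachWeight (β : ℝ) (n : ℕ) : Measurable (alg.reachWeight β n) :=
  measurable_const.indicator (alg.measurableSet_reachSet n)

lemma sum_pullEvent_mul (t : ℕ) (ω : Outcome N M S) (f : Fin N × Fin M → ℝ) :
    ∑ p, (alg.pullEvent p t).indicator 1 ω * f p =
      if (t : ℕ∞) < alg.stopTime ω then f (alg.chosen t ω) else 0 := by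
  by_cases hk : (t : ℕ∞) < alg.stopTime ω
  · simp [Set.indicator_apply, pullEvent, hk]
  · simp [pullEvent, hk]

lemma stoppedSum_of_le (ℓ : Fin N × Fin M → ℝ → ℝ) {n : ℕ} {ω : Outcome N M S}
    (h : (n : ℕ∞) ≤ alg.stopTime ω) : alg.stoppedSum ℓ n ω = histSum ℓ n (alg.obs n ω) := by
  rw [histSum_obs, stoppedSum]
  refine Finset.sum_congr rfl fun t ht => ?_
  rw [alg.sum_pullEvent_mul t ω fun p => ℓ p (ω.2 t p), if_pos]
  exact lt_of_lt_of_le (by exact_mod_cast Finset.mem_range.mp ht) h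

lemma stoppedSum_of_eq (ℓ : Fin N × Fin M → ℝ → ℝ) {n k : ℕ} (hk : k ≤ n) {ω : Outcome N M S}
    (h : alg.stopTime ω = k) : alg.stoppedSum ℓ n ω = histSum ℓ k (alg.obs k ω) := by
  rw [← alg.stoppedSum_of_le ℓ h.ge, stoppedSum, stoppedSum]
  symm
  refine Finset.sum_subset (Finset.range_mono hk) fun t _ ht => ?_
  rw [alg.sum_pullEvent_mul t ω fun p => ℓ p (ω.2 t p), if_neg]
  rw [h, Nat.cast_lt]
  simpa using ht

-- Splitting according to `τ = k < n` or `τ ≥ n` writes the stopped weight through full histories of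
-- fixed length, to which the fixed-time change of measure applies. On `τ ≥ n` nothing has been
-- returned before `n`, so the weight is `β` there.
open Classical in
lemma exp_returnWeight_sub_stoppedSum (ℓ : Fin N × Fin M → ℝ → ℝ) (n : ℕ)
    (p : Fin N × Fin M) (α β : ℝ) (ω : Outcome N M S) :
    ENNReal.ofReal (Real.exp (alg.returnWeight n p α β ω - alg.stoppedSum ℓ n ω)) =
      (∑ k ∈ Finset.range n, ENNReal.ofReal (Real.exp (-histSum ℓ k (alg.obs k ω))) *
        alg.stopWeight p α β k (alg.obs k ω)) +
      ENNReal.ofReal (Real.exp (-histSum ℓ n (alg.obs n ω))) *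
        alg.reachWeight β n (alg.obs n ω) := by
  have hs : ∀ k, alg.obs k ω ∈ alg.reachSet k ∩ alg.stopSet k ↔ alg.stopTime ω = k := fun k => by
    rw [Set.mem_inter_iff, obs_mem_reachSet_iff, ← stopTime_eq_iff]
  have hexp : ∀ a b : ℝ, ENNReal.ofReal (Real.exp (a - b)) =
      ENNReal.ofReal (Real.exp (-b)) * ENNReal.ofReal (Real.exp a) := fun a b => by
    rw [← ENNReal.ofReal_mul (Real.exp_pos _).le, ← Real.exp_add, neg_add_eq_sub]
  by_cases h : (n : ℕ∞) ≤ alg.stopTime ω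
  · rw [Finset.sum_eq_zero, zero_add, alg.stoppedSum_of_le ℓ h, hexp, returnWeight, if_neg,
      reachWeight, Set.indicator_of_mem (alg.obs_mem_reachSet_iff.mpr h)]
    · rintro ⟨k, hk, hk', -⟩
      rw [hk'] at h
      exact absurd (Nat.cast_le.mp h) (not_le.mpr hk)
    · intro k hk
      rw [stopWeight, Set.indicator_of_notMem, mul_zero]
      rw [hs]
      intro hk'
      rw [hk'] at h
      exact absurd (Nat.cast_le.mp h) (not_le.mpr (Finset.mem_range.mp hk))
  · have hn : alg.obs n ω ∉ alg.reachSet n := by rwa [obs_mem_reachSet_iff]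
    obtain ⟨k, hk⟩ := ENat.ne_top_iff_exists.mp (ne_top_of_lt (not_le.mp h))
    have hkn : k < n := by
      rw [← hk, not_le] at h
      exact_mod_cast h
    rw [reachWeight, Set.indicator_of_notMem hn, mul_zero, add_zero,
      Finset.sum_eq_single_of_mem k (Finset.mem_range.mpr hkn), stopWeight,
      Set.indicator_of_mem ((hs k).mpr hk.symm), alg.stoppedSum_of_eq ℓ hkn.le hk.symm, hexp]
    · congr 4
      unfold returnWeight
      refine if_congr ⟨?_, fun h => ⟨k, hkn, hk.symm, h⟩⟩ rfl rfl
      rintro ⟨j, -, hj, hj'⟩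
      obtain rfl : k = j := by exact_mod_cast hk.trans hj
      exact hj'
    · intro j _ hjk
      rw [stopWeight, Set.indicator_of_notMem, mul_zero]
      rw [hs, ← hk]
      exact_mod_cast hjk.symm

lemma lintegral_exp_returnWeight_sub_le (ν ν' : Fin N × Fin M → Measure ℝ)
    [∀ p, IsProbabilityMeasure (ν p)] [∀ p, IsProbabilityMeasure (ν' p)]
    {ℓ : Fin N × Fin M → ℝ → ℝ} (hℓ : ∀ p, Measurable (ℓ p))
    (hle : ∀ p (φ : ℝ → ℝ≥0∞), Measurable φ →
      ∫⁻ x, ENNReal.ofReal (Real.exp (-ℓ p x)) * φ x ∂(ν p) ≤ ∫⁻ x, φ x ∂(ν' p))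
    (n : ℕ) (p : Fin N × Fin M) (α β : ℝ) :
    ∫⁻ ω, ENNReal.ofReal (Real.exp (alg.returnWeight n p α β ω - alg.stoppedSum ℓ n ω))
        ∂(alg.pairLaw ν) ≤
      ∫⁻ ω, ENNReal.ofReal (Real.exp (alg.returnWeight n p α β ω)) ∂(alg.pairLaw ν') := by
  -- The same decomposition with `ℓ = 0` gives the right-hand integrand.
  have h0 : ∀ ω, ENNReal.ofReal (Real.exp (alg.returnWeight n p α β ω)) =
      (∑ k ∈ Finset.range n, alg.stopWeight p α β k (alg.obs k ω)) +
        alg.reachWeight β n (alg.obs n ω) := fun ω => by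
    simpa [stoppedSum, histSum] using
      alg.exp_returnWeight_sub_stoppedSum (fun _ _ => 0) n p α β ω
  have hms : ∀ k, Measurable fun ω => alg.stopWeight p α β k (alg.obs k ω) := fun k =>
    (alg.measurable_stopWeight p α β k).comp (alg.measurable_obs k)
  have hme : ∀ k, Measurable fun ω =>
      ENNReal.ofReal (Real.exp (-histSum ℓ k (alg.obs k ω))) := fun k =>
    ((measurable_histSum hℓ k).comp (alg.measurable_obs k)).neg.exp.ennreal_ofReal
  simp only [h0, alg.exp_returnWeight_sub_stoppedSum]
  have hmp : ∀ k, Measurable fun ω => ENNReal.ofReal (Real.exp (-histSum ℓ k (alg.obs k ω))) *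
      alg.stopWeight p α β k (alg.obs k ω) := fun k => Measurable.mul (hme k) (hms k)
  rw [lintegral_add_left (Finset.measurable_sum _ fun k _ => hmp k),
    lintegral_add_left (Finset.measurable_sum _ fun k _ => hms k),
    lintegral_finsetSum _ fun k _ => hmp k, lintegral_finsetSum _ fun k _ => hms k]
  exact add_le_add (Finset.sum_le_sum fun k _ =>
    alg.lintegral_exp_neg_histSum_mul_le ν ν' hℓ hle k (alg.measurable_stopWeight p α β k))
    (alg.lintegral_exp_neg_histSum_mul_le ν ν' hℓ hle n (alg.measurable_reachWeight β n))

end ChangeOfMeasure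

end Algorithm

/-! ### Log-likelihood ratios and the transportation inequality -/

/-- Almost everywhere for `μ`, `exp (-llr μ ν)` is the density of the absolutely continuous part of
`ν`. A singular part of `ν` is lost, hence only an inequality. -/
lemma lintegral_exp_neg_llr_mul_le {μ ν : Measure ℝ} [IsProbabilityMeasure μ]
    [IsProbabilityMeasure ν] (h : μ ≪ ν) {φ : ℝ → ℝ≥0∞} (hφ : Measurable φ) :
    ∫⁻ x, ENNReal.ofReal (Real.exp (-llr μ ν x)) * φ x ∂μ ≤ ∫⁻ x, φ x ∂ν := by
  have e : (fun x => ENNReal.ofReal (Real.exp (-llr μ ν x)) * φ x) =ᵐ[μ]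
      fun x => (ν.rnDeriv μ * φ) x := by
    filter_upwards [exp_neg_llr h, Measure.rnDeriv_lt_top ν μ] with x hx hlt
    rw [hx, ENNReal.ofReal_toReal hlt.ne, Pi.mul_apply]
  rw [lintegral_congr_ae e,
    ← lintegral_withDensity_eq_lintegral_mul _ (Measure.measurable_rnDeriv ν μ) hφ]
  exact lintegral_mono' (Measure.withDensity_rnDeriv_le ν μ) le_rfl

namespace Algorithm

variable {N M : ℕ} {S : Type*} [MeasurableSpace S] (alg : Algorithm N M S)

section

variable (ν : Fin N × Fin M → Measure ℝ) [∀ p, IsProbabilityMeasure (ν p)]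

lemma integrable_pull_mul {f : ℝ → ℝ} (t : ℕ) (p : Fin N × Fin M) (hf : Measurable f)
    (hi : Integrable f (ν p)) :
    Integrable (fun ω => (alg.pullEvent p t).indicator 1 ω * f (ω.2 t p)) (alg.pairLaw ν) ∧
      ∫ ω, (alg.pullEvent p t).indicator 1 ω * f (ω.2 t p) ∂(alg.pairLaw ν) =
        (alg.pairLaw ν).real (alg.pullEvent p t) * ∫ x, f x ∂(ν p) := by
  have hg : Measurable ((alg.pullSet p t).indicator (1 : S × Hist N M t → ℝ)) :=
    measurable_one.indicator (alg.measurableSet_pullSet p t)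
  have hind : IndepFun ((alg.pullEvent p t).indicator (1 : Outcome N M S → ℝ))
      (fun ω : Outcome N M S => f (ω.2 t p)) (alg.pairLaw ν) := by
    have := (alg.indepFun_obs_reward ν t).comp hg (hf.comp (measurable_pi_apply p))
    rw [pullEvent_eq]
    exact this
  have hX : Integrable ((alg.pullEvent p t).indicator (1 : Outcome N M S → ℝ))
      (alg.pairLaw ν) :=
    (integrable_const 1).indicator (alg.measurableSet_pullEvent p t)
  have hmr : Measurable fun ω : Outcome N M S => ω.2 t p := by fun_prop
  have hY : Integrable (fun ω : Outcome N M S => f (ω.2 t p)) (alg.pairLaw ν) := by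
    have h := hi
    rw [← alg.map_reward_apply ν t p] at h
    exact h.comp_measurable hmr
  refine ⟨hind.integrable_mul hX hY, ?_⟩
  rw [hind.integral_fun_mul_eq_mul_integral hX.aestronglyMeasurable hY.aestronglyMeasurable,
    integral_indicator_one (alg.measurableSet_pullEvent p t)]
  congr 1
  conv_rhs => rw [← alg.map_reward_apply ν t p]
  rw [integral_map hmr.aemeasurable hf.aestronglyMeasurable]

variable {ℓ : Fin N × Fin M → ℝ → ℝ}

lemma integrable_stoppedSum (hℓ : ∀ p, Measurable (ℓ p)) (hi : ∀ p, Integrable (ℓ p) (ν p))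
    (n : ℕ) : Integrable (alg.stoppedSum ℓ n) (alg.pairLaw ν) :=
  integrable_finsetSum _ fun t _ => integrable_finsetSum _ fun p _ =>
    (alg.integrable_pull_mul ν t p (hℓ p) (hi p)).1

/-- Wald's identity at a finite horizon. -/
lemma integral_stoppedSum (hℓ : ∀ p, Measurable (ℓ p)) (hi : ∀ p, Integrable (ℓ p) (ν p))
    (n : ℕ) : ∫ ω, alg.stoppedSum ℓ n ω ∂(alg.pairLaw ν) =
      ∑ p, (∑ t ∈ Finset.range n, (alg.pairLaw ν).real (alg.pullEvent p t)) *
        ∫ x, ℓ p x ∂(ν p) := by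
  unfold stoppedSum
  rw [integral_finsetSum _ fun t _ => integrable_finsetSum _ fun p _ =>
    (alg.integrable_pull_mul ν t p (hℓ p) (hi p)).1]
  simp_rw [integral_finsetSum _ fun p _ => (alg.integrable_pull_mul ν _ p (hℓ p) (hi p)).1,
    (alg.integrable_pull_mul ν _ _ (hℓ _) (hi _)).2, Finset.sum_mul]
  exact Finset.sum_comm

lemma returnWeight_eq (n : ℕ) (p : Fin N × Fin M) (α β : ℝ) :
    alg.returnWeight n p α β =
      fun ω => (α - β) * (alg.returnsBefore n p).indicator 1 ω + β := by
  funext ω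
  by_cases h : ω ∈ alg.returnsBefore n p <;> simp [returnWeight, h]

lemma exp_returnWeight (n : ℕ) (p : Fin N × Fin M) (α β : ℝ) (ω : Outcome N M S) :
    Real.exp (alg.returnWeight n p α β ω) =
      alg.returnWeight n p (Real.exp α) (Real.exp β) ω := by
  by_cases h : ω ∈ alg.returnsBefore n p <;> simp [returnWeight, h]

lemma integrable_returnWeight (n : ℕ) (p : Fin N × Fin M) (α β : ℝ) :
    Integrable (alg.returnWeight n p α β) (alg.pairLaw ν) := by
  rw [returnWeight_eq]
  exact (((integrable_const 1).indicator (alg.measurableSet_returnsBefore n p)).const_mul _).add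
    (integrable_const _)

lemma integral_returnWeight (n : ℕ) (p : Fin N × Fin M) (α β : ℝ) :
    ∫ ω, alg.returnWeight n p α β ω ∂(alg.pairLaw ν) =
      (α - β) * (alg.pairLaw ν).real (alg.returnsBefore n p) + β := by
  rw [returnWeight_eq, integral_add
    (((integrable_const 1).indicator (alg.measurableSet_returnsBefore n p)).const_mul _)
    (integrable_const _), integral_const_mul,
    integral_indicator_one (alg.measurableSet_returnsBefore n p)]
  simp

end

variable (ν ν' : Fin N × Fin M → Measure ℝ) [∀ p, IsProbabilityMeasure (ν p)]
  [∀ p, IsProbabilityMeasure (ν' p)]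

/-- A Donsker-Varadhan type bound. With `g` the two-valued weight and `L` the stopped log-likelihood
ratio, integrate `g - L + 1 ≤ exp (g - L)` under `ν`; the change of measure bounds the right side by
the integral of `exp g` under `ν'`, and Wald's identity evaluates that of `L`. -/
lemma variational_bound_returnsBefore (hac : ∀ p, ν p ≪ ν' p)
    (hi : ∀ p, Integrable (llr (ν p) (ν' p)) (ν p)) (n : ℕ) (p : Fin N × Fin M) (α β : ℝ) :
    (α - β) * (alg.pairLaw ν).real (alg.returnsBefore n p) + β + 1 ≤
      (∑ q, (∑ t ∈ Finset.range n, (alg.pairLaw ν).real (alg.pullEvent q t)) *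
        ∫ x, llr (ν q) (ν' q) x ∂(ν q)) +
      ((Real.exp α - Real.exp β) * (alg.pairLaw ν').real (alg.returnsBefore n p) +
        Real.exp β) := by
  have hℓ : ∀ q, Measurable (llr (ν q) (ν' q)) := fun q => measurable_llr _ _
  set L := alg.stoppedSum (fun q => llr (ν q) (ν' q)) n
  set g := alg.returnWeight n p α β
  have hL : Integrable L (alg.pairLaw ν) := alg.integrable_stoppedSum ν hℓ hi n
  have hg : Integrable g (alg.pairLaw ν) := alg.integrable_returnWeight ν n p α β
  have hge : Integrable (fun ω => Real.exp (g ω)) (alg.pairLaw ν') := by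
    simp only [g, exp_returnWeight]
    exact alg.integrable_returnWeight ν' n p _ _
  have hle : ∫⁻ ω, ENNReal.ofReal (Real.exp (g ω - L ω)) ∂(alg.pairLaw ν) ≤
      ENNReal.ofReal (∫ ω, Real.exp (g ω) ∂(alg.pairLaw ν')) := by
    rw [ofReal_integral_eq_lintegral_ofReal hge (ae_of_all _ fun _ => (Real.exp_pos _).le)]
    exact alg.lintegral_exp_returnWeight_sub_le ν ν' hℓ
      (fun q φ hφ => lintegral_exp_neg_llr_mul_le (hac q) hφ) n p α β
  have hsm : AEStronglyMeasurable (fun ω => Real.exp (g ω - L ω)) (alg.pairLaw ν) :=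
    Real.continuous_exp.comp_aestronglyMeasurable (hg.sub hL).aestronglyMeasurable
  have hWi : Integrable (fun ω => Real.exp (g ω - L ω)) (alg.pairLaw ν) :=
    (lintegral_ofReal_ne_top_iff_integrable hsm (ae_of_all _ fun _ => (Real.exp_pos _).le)).mp
      (ne_top_of_le_ne_top ENNReal.ofReal_ne_top hle)
  have hW : ∫ ω, Real.exp (g ω - L ω) ∂(alg.pairLaw ν) ≤
      ∫ ω, Real.exp (g ω) ∂(alg.pairLaw ν') := by
    rw [← ofReal_integral_eq_lintegral_ofReal hWi (ae_of_all _ fun _ => (Real.exp_pos _).le)]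
      at hle
    exact (ENNReal.ofReal_le_ofReal_iff (integral_nonneg fun _ => (Real.exp_pos _).le)).mp hle
  have hgL : Integrable (fun ω => g ω - L ω) (alg.pairLaw ν) := hg.sub hL
  have hmain : ∫ ω, (g ω - L ω + 1) ∂(alg.pairLaw ν) ≤
      ∫ ω, Real.exp (g ω - L ω) ∂(alg.pairLaw ν) :=
    integral_mono (hgL.add (integrable_const 1)) hWi fun ω => Real.add_one_le_exp _
  rw [integral_add hgL (integrable_const 1), integral_sub hg hL,
    alg.integral_returnWeight, alg.integral_stoppedSum ν hℓ hi] at hmain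
  simp only [g, exp_returnWeight, alg.integral_returnWeight] at hW
  simp only [integral_const, probReal_univ, smul_eq_mul, mul_one] at hmain
  linarith

/-- The change-of-measure inequality: if the algorithm returns `p` with probability at most `x`
under `ν` and at least `y ≥ x` under `ν'`, then the expected number of samples of each pair,
weighted by the divergences, is at least the binary relative entropy of `x` and `y`. -/
theorem binRelEntropy_le_sum_expectedPulls_mul_klDiv
    (hkl : ∀ q, InformationTheory.klDiv (ν q) (ν' q) ≠ ∞) (p : Fin N × Fin M) {x y : ℝ}
    (hx : 0 < x) (hxy : x ≤ y) (hy : y < 1) (hP : (alg.pairLaw ν).real (alg.returns p) ≤ x)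
    (hQ : y ≤ (alg.pairLaw ν').real (alg.returns p)) :
    ENNReal.ofReal (binRelEntropy x y) ≤
      ∑ q, alg.expectedPulls ν q * InformationTheory.klDiv (ν q) (ν' q) := by
  by_cases htop : ∑ q, alg.expectedPulls ν q * InformationTheory.klDiv (ν q) (ν' q) = ∞
  · rw [htop]; exact le_top
  rw [← ENNReal.ofReal_toReal htop]
  refine ENNReal.ofReal_le_ofReal ?_
  set T := (∑ q, alg.expectedPulls ν q * InformationTheory.klDiv (ν q) (ν' q)).toReal
  have hac := fun q => (InformationTheory.klDiv_ne_top_iff.mp (hkl q)).1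
  have hi := fun q => (InformationTheory.klDiv_ne_top_iff.mp (hkl q)).2
  have hbound : ∀ n, (∑ q, (∑ t ∈ Finset.range n, (alg.pairLaw ν).real (alg.pullEvent q t)) *
        ∫ x, llr (ν q) (ν' q) x ∂(ν q)) ≤ T := by
    intro n
    have e : ∀ q, (∑ t ∈ Finset.range n, (alg.pairLaw ν).real (alg.pullEvent q t)) *
        ∫ x, llr (ν q) (ν' q) x ∂(ν q) =
        ((∑ t ∈ Finset.range n, alg.pairLaw ν (alg.pullEvent q t)) *
          InformationTheory.klDiv (ν q) (ν' q)).toReal := fun q => by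
      rw [ENNReal.toReal_mul, InformationTheory.toReal_klDiv_of_measure_eq (hac q) (by simp),
        ENNReal.toReal_sum fun t _ => measure_ne_top _ _]
      rfl
    simp only [e]
    rw [← ENNReal.toReal_sum fun q _ => ENNReal.mul_ne_top
      (ENNReal.sum_ne_top.mpr fun t _ => measure_ne_top _ _) (hkl q)]
    exact ENNReal.toReal_mono htop (Finset.sum_le_sum fun q _ =>
      mul_le_mul_left (ENNReal.sum_le_tsum _) _)
  have hlim : ∀ α β : ℝ, (α - β) * (alg.pairLaw ν).real (alg.returns p) + β + 1 ≤
      T + ((Real.exp α - Real.exp β) * (alg.pairLaw ν').real (alg.returns p) + Real.exp β) := by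
    intro α β
    refine le_of_tendsto_of_tendsto'
      (((alg.tendsto_measureReal_returnsBefore (alg.pairLaw ν) p).const_mul
        (α - β)).add_const β |>.add_const 1)
      ((((alg.tendsto_measureReal_returnsBefore (alg.pairLaw ν') p).const_mul
        (Real.exp α - Real.exp β)).add_const (Real.exp β)).const_add T) fun n => ?_
    exact (alg.variational_bound_returnsBefore ν ν' hac hi n p α β).trans
      (by gcongr; exact hbound n)
  have hy0 : 0 < y := hx.trans_le hxy
  have hx1 : x < 1 := hxy.trans_lt hy
  have h1 : 0 < (1 - x) / (1 - y) := div_pos (by linarith) (by linarith)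
  -- These values are optimal when the two probabilities are exactly `x` and `y`: the exponential
  -- terms then sum to `1` (`k3`). Since `α ≤ 0 ≤ β`, replacing the probabilities by `x` and `y`
  -- goes in the right direction.
  have h := hlim (Real.log (x / y)) (Real.log ((1 - x) / (1 - y)))
  rw [Real.exp_log (div_pos hx hy0), Real.exp_log h1] at h
  have hr1 : x / y ≤ 1 := (div_le_one hy0).mpr hxy
  have hr2 : 1 ≤ (1 - x) / (1 - y) := (one_le_div (by linarith)).mpr (by linarith)
  have hl1 : Real.log (x / y) ≤ 0 := Real.log_nonpos (div_pos hx hy0).le hr1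
  have hl2 : 0 ≤ Real.log ((1 - x) / (1 - y)) := Real.log_nonneg hr2
  have k1 : (Real.log (x / y) - Real.log ((1 - x) / (1 - y))) * x ≤
      (Real.log (x / y) - Real.log ((1 - x) / (1 - y))) *
        (alg.pairLaw ν).real (alg.returns p) :=
    mul_le_mul_of_nonpos_left hP (by linarith)
  have k2 : (x / y - (1 - x) / (1 - y)) * (alg.pairLaw ν').real (alg.returns p) ≤
      (x / y - (1 - x) / (1 - y)) * y := mul_le_mul_of_nonpos_left hQ (by linarith)
  have k3 : (x / y - (1 - x) / (1 - y)) * y + (1 - x) / (1 - y) = 1 := by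
    have : 1 - y ≠ 0 := by linarith
    field_simp
    ring
  unfold binRelEntropy
  linarith

end Algorithm

/-! ### Lower bounds from perturbed instances -/

/-- Used to let the perturbation tend to zero. Finiteness of `n` matters when `K = 0`, where `∞ * 0
= 0`. -/
lemma ennreal_le_mul_of_forall_gt {c n K : ℝ≥0∞} (hn : n ≠ ∞) (hK : K ≠ ∞)
    (h : ∀ y, K < y → y ≠ ∞ → c ≤ n * y) : c ≤ n * K := by
  have hne : (nhdsWithin K (Set.Ioi K)).NeBot :=
    nhdsGT_neBot_of_exists_gt ⟨∞, lt_top_iff_ne_top.mpr hK⟩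
  have ht : Filter.Tendsto (fun y => n * y) (nhdsWithin K (Set.Ioi K)) (nhds (n * K)) :=
    (ENNReal.Tendsto.const_mul Filter.tendsto_id (Or.inr hn)).mono_left nhdsWithin_le_nhds
  refine ge_of_tendsto ht ?_
  filter_upwards [self_mem_nhdsWithin,
    nhdsWithin_le_nhds (Iio_mem_nhds (lt_top_iff_ne_top.mpr hK))] with y hy hy'
  exact h y hy hy'.ne

lemma binRelEntropy_half_pos {δ : ℝ} (hδ : 0 < δ) (hδ' : δ < 1 / 2) :
    0 < binRelEntropy (1 / 2) (1 - δ) := by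
  have h1 : (0 : ℝ) < 1 - δ := by linarith
  have e : binRelEntropy (1 / 2) (1 - δ) =
      1 / 2 * Real.log (1 / 2 / (1 - δ) * (1 / 2 / δ)) := by
    rw [Real.log_mul (by positivity) (by positivity)]
    unfold binRelEntropy
    ring_nf
  rw [e]
  refine mul_pos (by norm_num) (Real.log_pos ?_)
  rw [div_mul_div_comm, one_lt_div (by positivity)]
  nlinarith [sq_pos_of_pos (show (0 : ℝ) < 1 / 2 - δ by linarith)]

lemma klDiv_le_of_scale {F : ℝ → Measure ℝ} (hmono : KLMonotone F) {p q w w' : ℝ}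
    (hp : p ∈ Set.Icc 0 1) (hq : q ∈ Set.Icc 0 1) (hw : 0 < w) (hww' : w ≤ w') (hw' : w' ≤ 1) :
    InformationTheory.klDiv (F (p * w)) (F (q * w)) ≤
      InformationTheory.klDiv (F (p * w')) (F (q * w')) := by
  have hmem : ∀ {r s : ℝ}, r ∈ Set.Icc (0 : ℝ) 1 → 0 < s → s ≤ 1 → r * s ∈ Set.Icc (0 : ℝ) 1 :=
    fun hr h0 h1 => ⟨mul_nonneg hr.1 h0.le, mul_le_one₀ hr.2 h0.le h1⟩
  have e : ∀ r, w' / w * (r * w) = r * w' := fun r => by field_simp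
  have h := hmono (p * w) (q * w) (w' / w) (hmem hp hw (hww'.trans hw'))
    (hmem hq hw (hww'.trans hw')) ((one_le_div hw).mpr hww')
  rw [e, e] at h
  exact h (hmem hp (hw.trans_le hww') hw') (hmem hq (hw.trans_le hww') hw')

section Gap

variable {n : ℕ} [NeZero n] {w : Fin n → ℝ}

lemma iSup_eq_zero_of_antitone (hw : Antitone w) : ⨆ i, w i = w 0 :=
  le_antisymm (ciSup_le fun i => hw (Fin.zero_le i)) (le_ciSup (Set.finite_range w).bddAbove 0)

lemma gap_eq_of_antitone (hw : Antitone w) (i : Fin n) : gap w i = w 0 - w i := by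
  rw [gap, iSup_eq_zero_of_antitone hw]

lemma add_gap_of_antitone (hw : Antitone w) (i : Fin n) : w i + gap w i = w 0 := by
  rw [gap_eq_of_antitone hw]; ring

end Gap

/-- The reward distributions of all pairs. -/
abbrev rewards {N M : ℕ} (F : ℝ → Measure ℝ) (u : Fin N → ℝ) (v : Fin M → ℝ) :
    Fin N × Fin M → Measure ℝ := fun p => F (u p.1 * v p.2)

/-- The pair `p` is the unique best pair. -/
def UniqueBest {N M : ℕ} (u : Fin N → ℝ) (v : Fin M → ℝ) (p : Fin N × Fin M) : Prop :=
  ∀ q, q ≠ p → u q.1 * v q.2 < u p.1 * v p.2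

namespace Algorithm

variable {N M : ℕ} {S : Type*} [MeasurableSpace S] {alg : Algorithm N M S}
  {F : ℝ → Measure ℝ} [∀ μ, IsProbabilityMeasure (F μ)] {δ : ℝ}

lemma IsPAC.le_real_returns (h : alg.IsPAC F δ) {u : Fin N → ℝ} {v : Fin M → ℝ}
    (hu : ∀ i, u i ∈ Set.Ioo 0 1) (hv : ∀ j, v j ∈ Set.Ioo 0 1) {p : Fin N × Fin M}
    (hp : UniqueBest u v p) : 1 - δ ≤ (alg.pairLaw (rewards F u v)).real (alg.returns p) :=
  (ENNReal.ofReal_le_iff_le_toReal (measure_ne_top _ _)).mp (h u v hu hv p hp)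

lemma real_returns_add_le (μ : Measure (Outcome N M S)) [IsProbabilityMeasure μ]
    {p q : Fin N × Fin M} (hpq : p ≠ q) :
    μ.real (alg.returns p) + μ.real (alg.returns q) ≤ 1 := by
  rw [← measureReal_union (alg.disjoint_returns hpq) (alg.measurableSet_returns q)]
  exact measureReal_le_one

lemma sum_expectedPulls_le_expectedSamples (u : Fin N → ℝ) (v : Fin M → ℝ) :
    ∑ p, alg.expectedPulls (rewards F u v) p ≤ alg.expectedSamples F u v :=
  alg.sum_expectedPulls_le (rewards F u v)

lemma sum_expectedPulls_mul_le {u u' : Fin N → ℝ} {v v' : Fin M → ℝ}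
    (R : Finset (Fin N × Fin M)) {y : ℝ≥0∞}
    (hR : ∀ r ∈ R, InformationTheory.klDiv (rewards F u v r) (rewards F u' v' r) ≤ y)
    (hR' : ∀ r ∉ R, u' r.1 * v' r.2 = u r.1 * v r.2) :
    ∑ r, alg.expectedPulls (rewards F u v) r *
        InformationTheory.klDiv (rewards F u v r) (rewards F u' v' r) ≤
      (∑ r ∈ R, alg.expectedPulls (rewards F u v) r) * y := by
  rw [← Finset.sum_subset (Finset.subset_univ R), Finset.sum_mul]
  · exact Finset.sum_le_sum fun r hr => mul_le_mul_right (hR r hr) _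
  · intro r _ hr
    simp only [rewards, hR' r hr, InformationTheory.klDiv_self, mul_zero]

/-- If moving the reward parameters on a set `R` of pairs changes the best pair, then the pairs in
`R` have to be sampled often enough. -/
lemma IsPAC.div_klDiv_le_sum_expectedPulls (h : alg.IsPAC F δ) (hδ : 0 < δ) (hδ' : δ < 1 / 2)
    (husc : KLUpperSemicontinuousRight F) {u : Fin N → ℝ} {v : Fin M → ℝ}
    (hu : ∀ i, u i ∈ Set.Ioo 0 1) (hv : ∀ j, v j ∈ Set.Ioo 0 1) {p : Fin N × Fin M}
    (hp : UniqueBest u v p) (R : Finset (Fin N × Fin M)) {a b c : ℝ} (ha : 0 < a) (hab : a ≤ b)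
    (hbc : b < c) (hb1 : b < 1)
    (H : ∀ x, b < x → x < c → ∃ (u' : Fin N → ℝ) (v' : Fin M → ℝ) (q : Fin N × Fin M), q ≠ p ∧
      (∀ i, u' i ∈ Set.Ioo 0 1) ∧ (∀ j, v' j ∈ Set.Ioo 0 1) ∧ UniqueBest u' v' q ∧
      (∀ r ∈ R, InformationTheory.klDiv (rewards F u v r) (rewards F u' v' r) ≤
        InformationTheory.klDiv (F a) (F x)) ∧
      ∀ r ∉ R, u' r.1 * v' r.2 = u r.1 * v r.2) :
    1 / InformationTheory.klDiv (F a) (F b) * ENNReal.ofReal (binRelEntropy δ (1 - δ)) ≤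
      ∑ r ∈ R, alg.expectedPulls (rewards F u v) r := by
  by_cases hK : InformationTheory.klDiv (F a) (F b) = ∞
  · simp [hK]
  by_cases hn : ∑ r ∈ R, alg.expectedPulls (rewards F u v) r = ∞
  · rw [hn]; exact le_top
  rw [mul_comm, mul_one_div]
  refine ENNReal.div_le_of_le_mul (ennreal_le_mul_of_forall_gt hn hK fun y hy hy' => ?_)
  -- Semicontinuity provides a perturbed parameter `x > b` whose divergence is still below `y`.
  obtain ⟨x, hx, hbx, hxc⟩ := ((husc a b ha hab hb1 y hy).and
    (Ioo_mem_nhdsGT hbc)).exists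
  obtain ⟨u', v', q, hqp, hu', hv', hq, hR, hR'⟩ := H x hbx hxc
  have hRy := fun r hr => (hR r hr).trans hx.le
  refine (alg.binRelEntropy_le_sum_expectedPulls_mul_klDiv (rewards F u v) (rewards F u' v')
    (fun r => ?_) q hδ (by linarith) (by linarith) ?_ (h.le_real_returns hu' hv' hq)).trans
    (sum_expectedPulls_mul_le R hRy hR')
  · by_cases hr : r ∈ R
    · exact ne_top_of_le_ne_top hy' (hRy r hr)
    · simp only [rewards, hR' r hr, InformationTheory.klDiv_self, ne_eq, ENNReal.zero_ne_top,
        not_false_eq_true]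
  -- Before the perturbation `p` is returned with probability at least `1 - δ`, which leaves at most
  -- `δ` for `q`.
  · have h1 := h.le_real_returns hu hv hp
    have h2 := real_returns_add_le (alg := alg) (alg.pairLaw (rewards F u v)) hqp
    linarith

variable [NeZero N] [NeZero M]

/-- The confusing instance replaces `u i` by `x / v 0`, which gives the pair `(i, 0)` the parameter
`x`. The restriction `x < v 0` keeps the new row parameter below `1`. -/
lemma IsPAC.div_klDiv_le_sum_row (h : alg.IsPAC F δ) (hδ : 0 < δ) (hδ' : δ < 1 / 2)
    (hmono : KLMonotone F) (husc : KLUpperSemicontinuousRight F) {u : Fin N → ℝ} {v : Fin M → ℝ}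
    (hu : ∀ i, u i ∈ Set.Ioo 0 1) (hv : ∀ j, v j ∈ Set.Ioo 0 1) (hu_anti : Antitone u)
    (hv_anti : Antitone v) (hp : UniqueBest u v (0, 0)) {i : Fin N} (hi : i ≠ 0) :
    1 / InformationTheory.klDiv (F (u i * v 0)) (F (u 0 * v 0)) *
        ENNReal.ofReal (binRelEntropy δ (1 - δ)) ≤
      ∑ r with r.1 = i, alg.expectedPulls (rewards F u v) r := by
  have hv0 := (hv 0).1
  have hu0 : ∀ k, u k ≤ u 0 := fun k => hu_anti (Fin.zero_le k)
  have hv0' : ∀ k, v k ≤ v 0 := fun k => hv_anti (Fin.zero_le k)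
  refine h.div_klDiv_le_sum_expectedPulls hδ hδ' husc hu hv hp _ (c := v 0)
    (mul_pos (hu i).1 hv0) (mul_le_mul_of_nonneg_right (hu0 i) hv0.le)
    (mul_lt_of_lt_one_left hv0 (hu 0).2) (mul_lt_one_of_nonneg_of_lt_one_left (hu 0).1.le (hu 0).2
      (hv 0).2.le) fun x hx hxv => ?_
  have hx0 : u 0 < x / v 0 := (lt_div_iff₀ hv0).mpr hx
  have hx1 : x / v 0 < 1 := (div_lt_one hv0).mpr hxv
  have hxx : x / v 0 * v 0 = x := div_mul_cancel₀ x hv0.ne'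
  have hx00 : 0 < x / v 0 := (hu 0).1.trans hx0
  refine ⟨Function.update u i (x / v 0), v, (i, 0), fun e => hi (congrArg Prod.fst e), fun k => ?_,
    hv, ?_, ?_, ?_⟩
  · by_cases hk : k = i
    · subst hk; simpa using ⟨hx00, hx1⟩
    · simpa [hk] using hu k
  · rintro ⟨k, l⟩ hkl
    by_cases hk : k = i
    · subst hk
      have hl : l ≠ 0 := fun e => hkl (by rw [e])
      -- Uniqueness of the best pair gives `v l < v 0`, so that `(i, 0)` strictly beats the rest of
      -- its row.
      have h0 := hp (0, l) fun e => hl (congrArg Prod.snd e)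
      simpa using mul_lt_mul_of_pos_left (lt_of_mul_lt_mul_left h0 (hu 0).1.le) hx00
    · simp only [Function.update_self, Function.update_of_ne hk, hxx]
      exact (mul_le_mul (hu0 k) (hv0' l) (hv l).1.le (hu 0).1.le).trans_lt hx
  · rintro ⟨k, l⟩ hk
    obtain rfl : k = i := by simpa using hk
    have e := klDiv_le_of_scale hmono (p := u k) (q := x / v 0) ⟨(hu k).1.le, (hu k).2.le⟩
      ⟨hx00.le, hx1.le⟩ (hv l).1 (hv0' l) (hv 0).2.le
    rw [hxx] at e
    simpa [rewards] using e
  · rintro ⟨k, l⟩ hk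
    have hk' : k ≠ i := by simpa using hk
    simp [hk']

lemma IsPAC.div_klDiv_le_sum_column (h : alg.IsPAC F δ) (hδ : 0 < δ) (hδ' : δ < 1 / 2)
    (hmono : KLMonotone F) (husc : KLUpperSemicontinuousRight F) {u : Fin N → ℝ} {v : Fin M → ℝ}
    (hu : ∀ i, u i ∈ Set.Ioo 0 1) (hv : ∀ j, v j ∈ Set.Ioo 0 1) (hu_anti : Antitone u)
    (hv_anti : Antitone v) (hp : UniqueBest u v (0, 0)) {j : Fin M} (hj : j ≠ 0) :
    1 / InformationTheory.klDiv (F (u 0 * v j)) (F (u 0 * v 0)) *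
        ENNReal.ofReal (binRelEntropy δ (1 - δ)) ≤
      ∑ r with r.2 = j, alg.expectedPulls (rewards F u v) r := by
  have hu0 := (hu 0).1
  have hu0' : ∀ k, u k ≤ u 0 := fun k => hu_anti (Fin.zero_le k)
  have hv0' : ∀ k, v k ≤ v 0 := fun k => hv_anti (Fin.zero_le k)
  refine h.div_klDiv_le_sum_expectedPulls hδ hδ' husc hu hv hp _ (c := u 0)
    (mul_pos hu0 (hv j).1) (mul_le_mul_of_nonneg_left (hv0' j) hu0.le)
    (mul_lt_of_lt_one_right hu0 (hv 0).2) (mul_lt_one_of_nonneg_of_lt_one_left hu0.le (hu 0).2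
      (hv 0).2.le) fun x hx hxu => ?_
  have hx0 : v 0 < x / u 0 := (lt_div_iff₀' hu0).mpr hx
  have hx1 : x / u 0 < 1 := (div_lt_one hu0).mpr hxu
  have hxx : u 0 * (x / u 0) = x := mul_div_cancel₀ x hu0.ne'
  have hx00 : 0 < x / u 0 := (hv 0).1.trans hx0
  refine ⟨u, Function.update v j (x / u 0), (0, j), fun e => hj (congrArg Prod.snd e), hu,
    fun k => ?_, ?_, ?_, ?_⟩
  · by_cases hk : k = j
    · subst hk; simpa using ⟨hx00, hx1⟩
    · simpa [hk] using hv k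
  · rintro ⟨k, l⟩ hkl
    by_cases hl : l = j
    · subst hl
      have hk : k ≠ 0 := fun e => hkl (by rw [e])
      have h0 := hp (k, 0) fun e => hk (congrArg Prod.fst e)
      simpa using mul_lt_mul_of_pos_right (lt_of_mul_lt_mul_right h0 (hv 0).1.le) hx00
    · simp only [Function.update_self, Function.update_of_ne hl, hxx]
      exact (mul_le_mul (hu0' k) (hv0' l) (hv l).1.le (hu 0).1.le).trans_lt hx
  · rintro ⟨k, l⟩ hl
    obtain rfl : l = j := by simpa using hl
    have e := klDiv_le_of_scale hmono (p := v l) (q := x / u 0) ⟨(hv l).1.le, (hv l).2.le⟩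
      ⟨hx00.le, hx1.le⟩ (hu k).1 (hu0' k) (hu 0).2.le
    rw [mul_comm (x / u 0) (u 0), hxx] at e
    simpa [rewards, mul_comm] using e
  · rintro ⟨k, l⟩ hl
    have hl' : l ≠ j := by simpa using hl
    simp [hl']

/-- Without a unique best pair, the expected number of samples is infinite. -/
lemma IsPAC.expectedSamples_eq_top (h : alg.IsPAC F δ) (hδ : 0 < δ) (hδ' : δ < 1 / 2)
    (husc : KLUpperSemicontinuousRight F) {u : Fin N → ℝ} {v : Fin M → ℝ}
    (hu : ∀ i, u i ∈ Set.Ioo 0 1) (hv : ∀ j, v j ∈ Set.Ioo 0 1) (hu_anti : Antitone u)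
    (hv_anti : Antitone v) (hp : ¬ UniqueBest u v (0, 0)) : alg.expectedSamples F u v = ∞ := by
  have hu0 : ∀ k, u k ≤ u 0 := fun k => hu_anti (Fin.zero_le k)
  have hv0 : ∀ k, v k ≤ v 0 := fun k => hv_anti (Fin.zero_le k)
  obtain ⟨q, hq, hle⟩ : ∃ q : Fin N × Fin M, q ≠ (0, 0) ∧ u 0 * v 0 ≤ u q.1 * v q.2 := by
    simpa [UniqueBest] using hp
  have hqu : u q.1 = u 0 := le_antisymm (hu0 _) (by
    nlinarith [mul_le_mul_of_nonneg_left (hv0 q.2) (hu q.1).1.le, (hv 0).1])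
  have hqv : v q.2 = v 0 := le_antisymm (hv0 _) (by
    rw [hqu] at hle; exact le_of_mul_le_mul_left hle (hu 0).1)
  set P := alg.pairLaw (rewards F u v)
  -- The events of returning `q` and returning `(0, 0)` are disjoint, so one of them has probability
  -- at most `1/2`.
  obtain ⟨r, hru, hrv, hr⟩ : ∃ r : Fin N × Fin M, u r.1 = u 0 ∧ v r.2 = v 0 ∧
      P.real (alg.returns r) ≤ 1 / 2 := by
    by_contra! hcon
    have h1 := hcon q hqu hqv
    have h2 := hcon (0, 0) rfl rfl
    have h3 := real_returns_add_le (alg := alg) P hq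
    linarith
  by_contra htop
  have key : ENNReal.ofReal (binRelEntropy (1 / 2) (1 - δ)) ≤ alg.expectedSamples F u v * 0 := by
    refine ennreal_le_mul_of_forall_gt htop ENNReal.zero_ne_top fun y hy hy' => ?_
    -- Raising both the row and the column of `r` breaks all ties in favour of `r`.
    let u' : ℝ → Fin N → ℝ := fun ε => Function.update u r.1 (u 0 + ε)
    let v' : ℝ → Fin M → ℝ := fun ε => Function.update v r.2 (v 0 + ε)
    have hev : ∀ᶠ ε in nhdsWithin (0 : ℝ) (Set.Ioi 0), ∀ s : Fin N × Fin M,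
        InformationTheory.klDiv (rewards F u v s) (rewards F (u' ε) (v' ε) s) < y := by
      refine Filter.eventually_all.mpr fun s => ?_
      -- Pairs outside the row and column of `r` keep their parameter. All others approach theirs
      -- strictly from above, where semicontinuity at `p = q` makes the divergence small.
      by_cases hs : s.1 ≠ r.1 ∧ s.2 ≠ r.2
      · refine Filter.Eventually.of_forall fun ε => ?_
        simpa [rewards, u', v', hs.1, hs.2, InformationTheory.klDiv_self] using hy
      · have ht : Filter.Tendsto (fun ε => u' ε s.1 * v' ε s.2) (nhdsWithin (0 : ℝ) (Set.Ioi 0))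
            (nhdsWithin (u s.1 * v s.2) (Set.Ioi (u s.1 * v s.2))) := by
          have e1 : ∀ ε, u' ε s.1 = u s.1 + if s.1 = r.1 then ε else 0 := fun ε => by
            by_cases hk : s.1 = r.1
            · simp [u', hk, hru]
            · simp [u', hk]
          have e2 : ∀ ε, v' ε s.2 = v s.2 + if s.2 = r.2 then ε else 0 := fun ε => by
            by_cases hk : s.2 = r.2
            · simp [v', hk, hrv]
            · simp [v', hk]
          simp only [e1, e2]
          refine tendsto_nhdsWithin_iff.mpr ⟨?_, ?_⟩
          · have hc : Continuous fun ε : ℝ => (u s.1 + if s.1 = r.1 then ε else 0) *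
                (v s.2 + if s.2 = r.2 then ε else 0) := by
              split_ifs <;> fun_prop
            simpa using (hc.tendsto 0).mono_left nhdsWithin_le_nhds
          · filter_upwards [self_mem_nhdsWithin] with ε hε
            have hε' : (0 : ℝ) < ε := hε
            have hus := (hu s.1).1
            have hvs := (hv s.2).1
            rw [Set.mem_Ioi]
            split_ifs with k1 k2 k2
            · nlinarith [mul_pos hε' hus, mul_pos hε' hvs, mul_pos hε' hε']
            · nlinarith [mul_pos hε' hvs]
            · nlinarith [mul_pos hε' hus]
            · exact absurd ⟨k1, k2⟩ hs
        have hpos := mul_pos (hu s.1).1 (hv s.2).1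
        have hlt : u s.1 * v s.2 < 1 := mul_lt_one_of_nonneg_of_lt_one_left (hu s.1).1.le
          (hu s.1).2 (hv s.2).2.le
        refine ht.eventually (husc _ _ hpos le_rfl hlt y ?_)
        simpa [InformationTheory.klDiv_self] using hy
    obtain ⟨ε, hkl, hε, hε1⟩ := (hev.and (Ioo_mem_nhdsGT
      (lt_min (sub_pos.mpr (hu 0).2) (sub_pos.mpr (hv 0).2)))).exists
    have hεu : u 0 + ε < 1 := by linarith [min_le_left (1 - u 0) (1 - v 0)]
    have hεv : v 0 + ε < 1 := by linarith [min_le_right (1 - u 0) (1 - v 0)]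
    have hu'r : u' ε r.1 = u 0 + ε := by simp [u']
    have hv'r : v' ε r.2 = v 0 + ε := by simp [v']
    have hu'' : ∀ k, k ≠ r.1 → u' ε k = u k := fun k hk => by simp [u', hk]
    have hv'' : ∀ k, k ≠ r.2 → v' ε k = v k := fun k hk => by simp [v', hk]
    have hu'm : ∀ i, u' ε i ∈ Set.Ioo 0 1 := fun k => by
      by_cases hk : k = r.1
      · rw [hk, hu'r]; exact ⟨by linarith [(hu 0).1], hεu⟩
      · rw [hu'' k hk]; exact hu k
    have hv'm : ∀ i, v' ε i ∈ Set.Ioo 0 1 := fun k => by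
      by_cases hk : k = r.2
      · rw [hk, hv'r]; exact ⟨by linarith [(hv 0).1], hεv⟩
      · rw [hv'' k hk]; exact hv k
    have hu'lt : ∀ k, k ≠ r.1 → u' ε k < u' ε r.1 := fun k hk => by
      rw [hu'' k hk, hu'r]; linarith [hu0 k]
    have hv'lt : ∀ k, k ≠ r.2 → v' ε k < v' ε r.2 := fun k hk => by
      rw [hv'' k hk, hv'r]; linarith [hv0 k]
    have hbest : UniqueBest (u' ε) (v' ε) r := by
      rintro ⟨k, l⟩ hkl'
      by_cases hk : k = r.1
      · have hl : l ≠ r.2 := fun e => hkl' (by rw [hk, e])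
        rw [hk]
        exact mul_lt_mul_of_pos_left (hv'lt l hl) (hu'm r.1).1
      · have hlv : v' ε l ≤ v' ε r.2 := by
          by_cases hl : l = r.2
          · rw [hl]
          · exact (hv'lt l hl).le
        exact mul_lt_mul (hu'lt k hk) hlv (hv'm l).1 (hu'm r.1).1.le
    calc ENNReal.ofReal (binRelEntropy (1 / 2) (1 - δ))
        ≤ ∑ s, alg.expectedPulls (rewards F u v) s *
            InformationTheory.klDiv (rewards F u v s) (rewards F (u' ε) (v' ε) s) :=
          alg.binRelEntropy_le_sum_expectedPulls_mul_klDiv (rewards F u v)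
            (rewards F (u' ε) (v' ε)) (fun s => (hkl s).ne_top) r (by norm_num) (by linarith)
            (by linarith) hr (h.le_real_returns hu'm hv'm hbest)
      _ ≤ (∑ s, alg.expectedPulls (rewards F u v) s) * y := by
          rw [Finset.sum_mul]
          exact Finset.sum_le_sum fun s _ => mul_le_mul_right (hkl s).le _
      _ ≤ alg.expectedSamples F u v * y :=
          mul_le_mul_left (sum_expectedPulls_le_expectedSamples u v) _
  rw [mul_zero, nonpos_iff_eq_zero, ENNReal.ofReal_eq_zero] at key
  exact absurd (binRelEntropy_half_pos hδ hδ') (not_lt.mpr key)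

theorem IsPAC.rateKL_mul_le_expectedSamples (h : alg.IsPAC F δ) (hδ : 0 < δ) (hδ' : δ < 1 / 2)
    (hmono : KLMonotone F) (husc : KLUpperSemicontinuousRight F) {u : Fin N → ℝ} {v : Fin M → ℝ}
    (hu : ∀ i, u i ∈ Set.Ioo 0 1) (hv : ∀ j, v j ∈ Set.Ioo 0 1) (hu_anti : Antitone u)
    (hv_anti : Antitone v) :
    rateKL F u v * ENNReal.ofReal (binRelEntropy δ (1 - δ)) ≤ alg.expectedSamples F u v := by
  by_cases hp : UniqueBest u v (0, 0)
  swap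
  · rw [h.expectedSamples_eq_top hδ hδ' husc hu hv hu_anti hv_anti hp]; exact le_top
  simp only [rateKL, add_gap_of_antitone hu_anti, add_gap_of_antitone hv_anti]
  set D := ENNReal.ofReal (binRelEntropy δ (1 - δ))
  set T := alg.expectedSamples F u v
  have hrow : (∑ i : Fin N with i ≠ 0,
      1 / InformationTheory.klDiv (F (u i * v 0)) (F (u 0 * v 0))) * D ≤ T := by
    rw [Finset.sum_mul]
    calc _ ≤ ∑ i : Fin N with i ≠ 0, ∑ r with r.1 = i, alg.expectedPulls (rewards F u v) r :=
          Finset.sum_le_sum fun i hi => h.div_klDiv_le_sum_row hδ hδ' hmono husc hu hv hu_anti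
            hv_anti hp (Finset.mem_filter.mp hi).2
      _ ≤ ∑ i : Fin N, ∑ r with r.1 = i, alg.expectedPulls (rewards F u v) r :=
          Finset.sum_le_sum_of_subset (Finset.filter_subset _ _)
      _ ≤ T := (Finset.sum_fiberwise _ _ _).trans_le (sum_expectedPulls_le_expectedSamples u v)
  have hcol : (∑ j : Fin M with j ≠ 0,
      1 / InformationTheory.klDiv (F (u 0 * v j)) (F (u 0 * v 0))) * D ≤ T := by
    rw [Finset.sum_mul]
    calc _ ≤ ∑ j : Fin M with j ≠ 0, ∑ r with r.2 = j, alg.expectedPulls (rewards F u v) r :=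
          Finset.sum_le_sum fun j hj => h.div_klDiv_le_sum_column hδ hδ' hmono husc hu hv hu_anti
            hv_anti hp (Finset.mem_filter.mp hj).2
      _ ≤ ∑ j : Fin M, ∑ r with r.2 = j, alg.expectedPulls (rewards F u v) r :=
          Finset.sum_le_sum_of_subset (Finset.filter_subset _ _)
      _ ≤ T := (Finset.sum_fiberwise _ _ _).trans_le (sum_expectedPulls_le_expectedSamples u v)
  -- Each sample counts once for its row and once for its column, hence the factor `1/2`.
  calc _ = 1 / 2 * (_ * D + _ * D) := by rw [mul_assoc, add_mul]
    _ ≤ 1 / 2 * (T + T) := mul_le_mul_right (add_le_add hrow hcol) _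
    _ = T := by
      rw [← two_mul, ← mul_assoc, one_div, ENNReal.inv_mul_cancel two_ne_zero ENNReal.ofNat_ne_top,
        one_mul]

end Algorithm

/-! ### Divergences from densities; Gaussian rewards -/

lemma klDiv_eq_ofReal_integral_of_withDensity {μ ν : Measure ℝ} [IsProbabilityMeasure μ]
    [IsProbabilityMeasure ν] {g : ℝ → ℝ} (hg : Measurable g) (hi : Integrable g μ)
    (h : μ = ν.withDensity fun x => ENNReal.ofReal (Real.exp (g x))) :
    InformationTheory.klDiv μ ν = ENNReal.ofReal (∫ x, g x ∂μ) := by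
  have hac : μ ≪ ν := h ▸ withDensity_absolutelyContinuous _ _
  have hr : μ.rnDeriv ν =ᵐ[μ] fun x => ENNReal.ofReal (Real.exp (g x)) := by
    have hr : (ν.withDensity fun x => ENNReal.ofReal (Real.exp (g x))).rnDeriv ν =ᵐ[ν]
        fun x => ENNReal.ofReal (Real.exp (g x)) :=
      Measure.rnDeriv_withDensity ν hg.exp.ennreal_ofReal
    rw [← h] at hr
    exact hac.ae_le hr
  have hl : llr μ ν =ᵐ[μ] g := by
    filter_upwards [hr] with x hx
    rw [llr, hx, ENNReal.toReal_ofReal (Real.exp_pos _).le, Real.log_exp]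
  rw [InformationTheory.klDiv_of_ac_of_integrable hac ((integrable_congr hl).mpr hi),
    integral_congr_ae hl]
  simp

section Gaussian

lemma klDiv_gaussianReward (p q : ℝ) :
    InformationTheory.klDiv (gaussianReward p) (gaussianReward q) =
      ENNReal.ofReal ((p - q) ^ 2 / 2) := by
  have hid : Integrable (fun x : ℝ => x) (gaussianReward p) :=
    memLp_one_iff_integrable.mp (memLp_id_gaussianReal (μ := p) (v := 1) 1)
  have hint : ∫ x, x ∂(gaussianReward p) = p := integral_id_gaussianReal
  have hd : gaussianReward p = (gaussianReward q).withDensity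
      fun x => ENNReal.ofReal (Real.exp ((p - q) * x - (p ^ 2 - q ^ 2) / 2)) := by
    rw [gaussianReward, gaussianReward, gaussianReal_of_var_ne_zero p one_ne_zero,
      gaussianReal_of_var_ne_zero q one_ne_zero,
      ← withDensity_mul _ (measurable_gaussianPDF q 1) (by fun_prop)]
    congr 1
    funext x
    rw [Pi.mul_apply, gaussianPDF, gaussianPDF, ← ENNReal.ofReal_mul (gaussianPDFReal_nonneg _ _ _)]
    simp only [gaussianPDFReal_def]
    rw [mul_assoc _ (Real.exp _) (Real.exp _), ← Real.exp_add]
    congr 3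
    simp only [NNReal.coe_one]
    ring
  have hi : Integrable (fun x : ℝ => (p - q) * x - (p ^ 2 - q ^ 2) / 2) (gaussianReward p) :=
    (hid.const_mul _).sub (integrable_const _)
  rw [klDiv_eq_ofReal_integral_of_withDensity (by fun_prop) hi hd,
    integral_sub (hid.const_mul _) (integrable_const _), integral_const_mul, hint]
  congr 1
  simp only [integral_const, probReal_univ, smul_eq_mul]
  ring

lemma klMonotone_gaussianReward : KLMonotone gaussianReward := by
  intro p q κ _ _ hκ _ _
  rw [klDiv_gaussianReward, klDiv_gaussianReward, ← mul_sub, mul_pow]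
  refine ENNReal.ofReal_le_ofReal ?_
  have h1 : 1 ≤ κ ^ 2 := one_le_pow₀ hκ
  nlinarith [mul_nonneg (sub_nonneg.mpr h1) (sq_nonneg (p - q))]

lemma klUpperSemicontinuousRight_gaussianReward : KLUpperSemicontinuousRight gaussianReward := by
  intro p q _ _ _
  simp only [klDiv_gaussianReward]
  have : Continuous fun x : ℝ => ENNReal.ofReal ((p - x) ^ 2 / 2) :=
    ENNReal.continuous_ofReal.comp (by fun_prop)
  exact this.upperSemicontinuous.upperSemicontinuousWithinAt _ _

end Gaussian

/-! ### Bernoulli rewards -/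

section Bernoulli

lemma lintegral_bernoulliReward {p : ℝ} (hp : p ∈ Set.Icc (0 : ℝ) 1) (f : ℝ → ℝ≥0∞) :
    ∫⁻ x, f x ∂(bernoulliReward p) =
      ENNReal.ofReal p * f 1 + ENNReal.ofReal (1 - p) * f 0 := by
  have h1 : ((unitInterval.toNNReal ⟨p, hp⟩ : NNReal) : ℝ≥0∞) = ENNReal.ofReal p := by
    rw [ENNReal.ofReal_eq_coe_nnreal hp.1]; rfl
  have h2 : ((unitInterval.toNNReal (unitInterval.symm ⟨p, hp⟩) : NNReal) : ℝ≥0∞) =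
      ENNReal.ofReal (1 - p) := by
    rw [ENNReal.ofReal_eq_coe_nnreal (sub_nonneg.mpr hp.2)]; rfl
  rw [bernoulliReward, Set.projIcc_of_mem zero_le_one hp, bernoulliMeasure_def,
    lintegral_add_measure, lintegral_smul_measure, lintegral_smul_measure, lintegral_dirac,
    lintegral_dirac, ← h1, ← h2]
  rfl

lemma integral_bernoulliReward {p : ℝ} (hp : p ∈ Set.Icc (0 : ℝ) 1) (f : ℝ → ℝ) :
    ∫ x, f x ∂(bernoulliReward p) = p * f 1 + (1 - p) * f 0 := by
  rw [bernoulliReward, Set.projIcc_of_mem zero_le_one hp, integral_bernoulliMeasure]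
  rfl

lemma klDiv_bernoulliReward {p q : ℝ} (hp : p ∈ Set.Ioo (0 : ℝ) 1) (hq : q ∈ Set.Ioo (0 : ℝ) 1) :
    InformationTheory.klDiv (bernoulliReward p) (bernoulliReward q) =
      ENNReal.ofReal (binRelEntropy p q) := by
  let g : ℝ → ℝ := fun y => if y = 1 then Real.log (p / q) else Real.log ((1 - p) / (1 - q))
  have hg : Measurable g :=
    Measurable.ite (measurableSet_singleton 1) measurable_const measurable_const
  have hp' : p ∈ Set.Icc (0 : ℝ) 1 := Set.Ioo_subset_Icc_self hp
  have hq' : q ∈ Set.Icc (0 : ℝ) 1 := Set.Ioo_subset_Icc_self hq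
  have hp1 : 0 < 1 - p := sub_pos.mpr hp.2
  have hq1 : 0 < 1 - q := sub_pos.mpr hq.2
  have hd : bernoulliReward p =
      (bernoulliReward q).withDensity fun x => ENNReal.ofReal (Real.exp (g x)) := by
    refine Measure.ext_of_lintegral _ fun f hf => ?_
    rw [lintegral_withDensity_eq_lintegral_mul _ hg.exp.ennreal_ofReal hf,
      lintegral_bernoulliReward hp', lintegral_bernoulliReward hq']
    simp only [Pi.mul_apply, g, if_true, zero_ne_one, if_false]
    rw [Real.exp_log (div_pos hp.1 hq.1), Real.exp_log (div_pos hp1 hq1), ← mul_assoc, ← mul_assoc,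
      ← ENNReal.ofReal_mul hq.1.le, ← ENNReal.ofReal_mul hq1.le, mul_div_cancel₀ _ hq.1.ne',
      mul_div_cancel₀ _ hq1.ne']
  have hi : Integrable g (bernoulliReward p) := integrable_bernoulliMeasure _ _ _ _
  rw [klDiv_eq_ofReal_integral_of_withDensity hg hi hd, integral_bernoulliReward hp']
  simp [g, binRelEntropy]

lemma map_mul_prod_bernoulliReward {b c : ℝ} (hb : b ∈ Set.Icc (0 : ℝ) 1)
    (hc : c ∈ Set.Icc (0 : ℝ) 1) :
    ((bernoulliReward b).prod (bernoulliReward c)).map (fun x => x.1 * x.2) =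
      bernoulliReward (b * c) := by
  have hbc : b * c ∈ Set.Icc (0 : ℝ) 1 := ⟨mul_nonneg hb.1 hc.1, mul_le_one₀ hb.2 hc.1 hc.2⟩
  refine Measure.ext_of_lintegral _ fun f hf => ?_
  rw [lintegral_map hf (by fun_prop), lintegral_prod _ (by fun_prop),
    lintegral_bernoulliReward hb, lintegral_bernoulliReward hc, lintegral_bernoulliReward hc,
    lintegral_bernoulliReward hbc]
  have h1 : ENNReal.ofReal (1 - b * c) = ENNReal.ofReal b * ENNReal.ofReal (1 - c) +
      ENNReal.ofReal (1 - b) * (ENNReal.ofReal c + ENNReal.ofReal (1 - c)) := by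
    have hb1 := sub_nonneg.mpr hb.2
    have hc1 := sub_nonneg.mpr hc.2
    rw [← ENNReal.ofReal_add hc.1 hc1, ← ENNReal.ofReal_mul hb.1, ← ENNReal.ofReal_mul hb1,
      ← ENNReal.ofReal_add (mul_nonneg hb.1 hc1) (by simpa using hb1)]
    congr 1
    ring
  rw [h1, ENNReal.ofReal_mul hb.1]
  simp only [mul_one, mul_zero]
  ring

/-- Data processing: multiplying a `Ber(κ r)` variable by an independent `Ber(1/κ)` variable yields
`Ber(r)`, and adjoining the same independent factor to both laws leaves their divergence unchanged.
-/
lemma klMonotone_bernoulliReward : KLMonotone bernoulliReward := by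
  intro p q κ _ _ hκ hp hq
  have hκ0 : 0 < κ := zero_lt_one.trans_le hκ
  have hc : κ⁻¹ ∈ Set.Icc (0 : ℝ) 1 := ⟨(inv_pos.mpr hκ0).le, inv_le_one_of_one_le₀ hκ⟩
  have e : ∀ r, κ * r * κ⁻¹ = r := fun r => by field_simp
  have hm := InformationTheory.klDiv_map_le (g := fun x : ℝ × ℝ => x.1 * x.2)
    (μ := (bernoulliReward (κ * p)).prod (bernoulliReward κ⁻¹))
    (ν := (bernoulliReward (κ * q)).prod (bernoulliReward κ⁻¹)) (by fun_prop)
  rwa [map_mul_prod_bernoulliReward hp hc, map_mul_prod_bernoulliReward hq hc, e, e,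
    ← Measure.compProd_const, ← Measure.compProd_const,
    InformationTheory.klDiv_compProd_left] at hm

lemma continuousAt_binRelEntropy {p q : ℝ} (hp : p ∈ Set.Ioo (0 : ℝ) 1)
    (hq : q ∈ Set.Ioo (0 : ℝ) 1) : ContinuousAt (binRelEntropy p) q := by
  have hp1 : 0 < 1 - p := sub_pos.mpr hp.2
  have hq1 : 0 < 1 - q := sub_pos.mpr hq.2
  unfold binRelEntropy
  refine ContinuousAt.add ?_ ?_
  · exact continuousAt_const.mul ((continuousAt_const.div continuousAt_id hq.1.ne').log
      (div_pos hp.1 hq.1).ne')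
  · exact continuousAt_const.mul ((continuousAt_const.div (by fun_prop) hq1.ne').log
      (div_pos hp1 hq1).ne')

lemma klUpperSemicontinuousRight_bernoulliReward : KLUpperSemicontinuousRight bernoulliReward := by
  intro p q hp hpq hq
  have hp' : p ∈ Set.Ioo (0 : ℝ) 1 := ⟨hp, hpq.trans_lt hq⟩
  have hq' : q ∈ Set.Ioo (0 : ℝ) 1 := ⟨hp.trans_le hpq, hq⟩
  have hc : ContinuousAt
      (fun x => InformationTheory.klDiv (bernoulliReward p) (bernoulliReward x)) q := by
    refine (ENNReal.continuous_ofReal.continuousAt.comp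
      (continuousAt_binRelEntropy hp' hq')).congr ?_
    filter_upwards [Ioo_mem_nhds hq'.1 hq'.2] with x hx
    exact (klDiv_bernoulliReward hp' hx).symm
  exact hc.upperSemicontinuousAt.upperSemicontinuousWithinAt _

/-- By `log t ≤ t - 1` the relative entropy is at most the chi-square divergence. -/
lemma binRelEntropy_le {p q : ℝ} (hp : p ∈ Set.Ioo (0 : ℝ) 1) (hq : q ∈ Set.Ioo (0 : ℝ) 1) :
    binRelEntropy p q ≤ (p - q) ^ 2 / (q * (1 - q)) := by
  have hp1 : 0 < 1 - p := sub_pos.mpr hp.2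
  have hq1 : 0 < 1 - q := sub_pos.mpr hq.2
  have hq0 := hq.1
  have h1 := mul_le_mul_of_nonneg_left (Real.log_le_sub_one_of_pos (div_pos hp.1 hq.1)) hp.1.le
  have h2 := mul_le_mul_of_nonneg_left (Real.log_le_sub_one_of_pos (div_pos hp1 hq1)) hp1.le
  have e : (p - q) ^ 2 / (q * (1 - q)) =
      p * (p / q - 1) + (1 - p) * ((1 - p) / (1 - q) - 1) := by
    field_simp
    ring
  rw [e]
  exact add_le_add h1 h2

lemma klDiv_bernoulliReward_le {p q : ℝ} (hp : p ∈ Set.Ioo (0 : ℝ) 1)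
    (hq : q ∈ Set.Ioo (0 : ℝ) 1) :
    InformationTheory.klDiv (bernoulliReward p) (bernoulliReward q) ≤
      ENNReal.ofReal ((q - p) ^ 2 / (2 * (min q (1 - q) / 4))) := by
  rw [klDiv_bernoulliReward hp hq]
  refine ENNReal.ofReal_le_ofReal ((binRelEntropy_le hp hq).trans ?_)
  have hq1 : 0 < 1 - q := sub_pos.mpr hq.2
  have hq0 := hq.1
  rw [show (p - q) ^ 2 = (q - p) ^ 2 by ring]
  refine div_le_div_of_nonneg_left (sq_nonneg _) (by positivity) ?_
  -- The larger of `q` and `1 - q` is at least `1/2`, so `q * (1 - q)` is at least half the smaller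
  -- one.
  rcases le_total q (1 - q) with h | h
  · rw [min_eq_left h]; nlinarith
  · rw [min_eq_right h]; nlinarith

end Bernoulli

/-! ### Explicit constants -/

/-- The difference of `d(δ, 1 - δ)` and `log (1 / δ)` is `2 δ log δ + (1 - 2 δ) log (1 - δ)`. The
first term is at least `-2 / e > -0.736`, the second at least `-0.264`. -/
lemma log_inv_sub_one_le_binRelEntropy {δ : ℝ} (hδ : 0 < δ) (hδ' : δ < 1 / 2) :
    Real.log (1 / δ) - 1 ≤ binRelEntropy δ (1 - δ) := by
  have h1 : 0 < 1 - δ := by linarith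
  have hlog : 1 - (1 - δ)⁻¹ ≤ Real.log (1 - δ) := Real.one_sub_inv_le_log_of_pos h1
  have hexp : -(δ * Real.log δ) ≤ Real.exp (-1) := by
    have h := Real.add_one_le_exp (-1 - Real.log δ)
    rw [Real.exp_sub, Real.exp_log hδ, le_div_iff₀ hδ] at h
    linarith
  have he := Real.exp_neg_one_lt_d9
  have hprod : -(0.264 : ℝ) ≤ (1 - 2 * δ) * (1 - (1 - δ)⁻¹) := by
    have e : (1 - 2 * δ) * (1 - (1 - δ)⁻¹) = -((1 - 2 * δ) * δ / (1 - δ)) := by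
      field_simp
      ring
    rw [e, neg_le_neg_iff, div_le_iff₀ h1]
    nlinarith [sq_nonneg (δ - 0.316)]
  have hmul := mul_le_mul_of_nonneg_left hlog (show 0 ≤ 1 - 2 * δ by linarith)
  have eq : binRelEntropy δ (1 - δ) = (1 - 2 * δ) * (Real.log (1 - δ) - Real.log δ) := by
    rw [binRelEntropy, sub_sub_cancel, Real.log_div hδ.ne' h1.ne', Real.log_div h1.ne' hδ.ne']
    ring
  rw [eq, one_div, Real.log_inv]
  linarith

section Rate

variable {N M : ℕ} [NeZero N] [NeZero M] {u : Fin N → ℝ} {v : Fin M → ℝ}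

lemma rate_nonneg (u : Fin N → ℝ) (v : Fin M → ℝ) : 0 ≤ rate u v := by
  unfold rate; positivity

/-- The index `0` has gap zero, so the positive gaps all occur among `i ≠ 0`. The factor `2`
compensates the `1 / 2` in `rateKL`. -/
lemma ofReal_two_mul_sum_gap_le {n : ℕ} [NeZero n] {w : Fin n → ℝ} (hw : Antitone w) {s C : ℝ}
    (hC : 0 < C) (hs : 0 < s) {K : Fin n → ℝ≥0∞}
    (hK : ∀ i, 0 < gap w i → K i ≤ ENNReal.ofReal ((s * gap w i) ^ 2 / (2 * C))) :
    ENNReal.ofReal (2 * C * ∑ i with 0 < gap w i, 1 / (s * gap w i) ^ 2) ≤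
      ∑ i with i ≠ 0, 1 / K i := by
  rw [Finset.mul_sum, ENNReal.ofReal_sum_of_nonneg fun i _ => by positivity]
  have hsub : (Finset.univ.filter fun i => 0 < gap w i) ⊆ Finset.univ.filter fun i => i ≠ 0 := by
    intro i hi
    rw [Finset.mem_filter] at hi ⊢
    refine ⟨hi.1, fun e => ?_⟩
    rw [e, gap_eq_of_antitone hw, sub_self] at hi
    exact lt_irrefl _ hi.2
  refine le_trans (Finset.sum_le_sum fun i hi => ?_) (Finset.sum_le_sum_of_subset hsub)
  have hi' := (Finset.mem_filter.mp hi).2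
  have hpos : 0 < (s * gap w i) ^ 2 / (2 * C) := by positivity
  calc ENNReal.ofReal (2 * C * (1 / (s * gap w i) ^ 2))
      = 1 / ENNReal.ofReal ((s * gap w i) ^ 2 / (2 * C)) := by
        rw [one_div (ENNReal.ofReal _), ← ENNReal.ofReal_inv_of_pos hpos, inv_div, mul_one_div]
    _ ≤ 1 / K i := ENNReal.div_le_div_left (hK i hi') 1

lemma ofReal_mul_rate_le_rateKL (hu : ∀ i, u i ∈ Set.Ioo 0 1) (hv : ∀ j, v j ∈ Set.Ioo 0 1)
    (hu_anti : Antitone u) (hv_anti : Antitone v) {F : ℝ → Measure ℝ} {C : ℝ} (hC : 0 < C)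
    (hF : ∀ p ∈ Set.Ioo (0 : ℝ) 1, InformationTheory.klDiv (F p) (F (u 0 * v 0)) ≤
      ENNReal.ofReal ((u 0 * v 0 - p) ^ 2 / (2 * C))) :
    ENNReal.ofReal (C * rate u v) ≤ rateKL F u v := by
  have hmem : ∀ i j, u i * v j ∈ Set.Ioo (0 : ℝ) 1 := fun i j =>
    ⟨mul_pos (hu i).1 (hv j).1, mul_lt_one_of_nonneg_of_lt_one_left (hu i).1.le (hu i).2
      (hv j).2.le⟩
  have hrow := ofReal_two_mul_sum_gap_le hu_anti hC (hv 0).1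
    (K := fun i => InformationTheory.klDiv (F (u i * v 0)) (F ((u i + gap u i) * v 0)))
    fun i _ => by
      have h := hF _ (hmem i 0)
      rw [show u 0 * v 0 - u i * v 0 = v 0 * (u 0 - u i) by ring] at h
      rwa [add_gap_of_antitone hu_anti, gap_eq_of_antitone hu_anti]
  have hcol := ofReal_two_mul_sum_gap_le hv_anti hC (hu 0).1
    (K := fun j => InformationTheory.klDiv (F (u 0 * v j)) (F (u 0 * (v j + gap v j))))
    fun j _ => by
      have h := hF _ (hmem 0 j)
      rw [show u 0 * v 0 - u 0 * v j = u 0 * (v 0 - v j) by ring] at h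
      rwa [add_gap_of_antitone hv_anti, gap_eq_of_antitone hv_anti]
  have e : C * rate u v = 1 / 2 *
      ((2 * C * ∑ i with 0 < gap u i, 1 / (v 0 * gap u i) ^ 2) +
        2 * C * ∑ j with 0 < gap v j, 1 / (u 0 * gap v j) ^ 2) := by
    rw [rate]; ring
  have ehalf : ENNReal.ofReal (1 / 2) = 1 / 2 := by
    rw [ENNReal.ofReal_div_of_pos two_pos, ENNReal.ofReal_one, ENNReal.ofReal_ofNat]
  rw [e, ENNReal.ofReal_mul (by norm_num), ehalf,
    ENNReal.ofReal_add (by positivity) (by positivity), rateKL]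
  exact mul_le_mul_right (add_le_add hrow hcol) _

lemma ofReal_mul_rate_mul_log_le (hu : ∀ i, u i ∈ Set.Ioo 0 1) (hv : ∀ j, v j ∈ Set.Ioo 0 1)
    (hu_anti : Antitone u) (hv_anti : Antitone v) {F : ℝ → Measure ℝ} {C : ℝ} (hC : 0 < C)
    (hF : ∀ p ∈ Set.Ioo (0 : ℝ) 1, InformationTheory.klDiv (F p) (F (u 0 * v 0)) ≤
      ENNReal.ofReal ((u 0 * v 0 - p) ^ 2 / (2 * C))) {δ : ℝ} (hδ : 0 < δ) (hδ' : δ < 1 / 2) :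
    ENNReal.ofReal (C * rate u v * (Real.log (1 / δ) - 1)) ≤
      rateKL F u v * ENNReal.ofReal (binRelEntropy δ (1 - δ)) := by
  -- The factor `log (1 / δ) - 1` may be negative and is then truncated to `0`; only the other
  -- factor has to be nonnegative.
  rw [ENNReal.ofReal_mul (mul_nonneg hC.le (rate_nonneg u v))]
  exact mul_le_mul' (ofReal_mul_rate_le_rateKL hu hv hu_anti hv_anti hC hF)
    (ENNReal.ofReal_le_ofReal (log_inv_sub_one_le_binRelEntropy hδ hδ'))

end Rate

end PairBandit

end

theorem mainTheorem3 {N M : ℕ} [NeZero N] [NeZero M] {S : Type*} [MeasurableSpace S]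
    (alg : PairBandit.Algorithm N M S) (δ : ℝ) (hδ : 0 < δ) (hδ' : δ < 1 / 2)
    (u : Fin N → ℝ) (v : Fin M → ℝ)
    (hu : ∀ i, u i ∈ Set.Ioo 0 1) (hv : ∀ j, v j ∈ Set.Ioo 0 1)
    (hu_anti : Antitone u) (hv_anti : Antitone v) :
    (∀ (F : ℝ → Measure ℝ) [∀ μ, IsProbabilityMeasure (F μ)],
      PairBandit.KLMonotone F → PairBandit.KLUpperSemicontinuousRight F → alg.IsPAC F δ →
        PairBandit.rateKL F u v * ENNReal.ofReal (PairBandit.binRelEntropy δ (1 - δ)) ≤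
          alg.expectedSamples F u v) ∧
    (alg.IsPAC PairBandit.gaussianReward δ →
      ENNReal.ofReal (PairBandit.rate u v * (Real.log (1 / δ) - 1)) ≤
        alg.expectedSamples PairBandit.gaussianReward u v) ∧
    (alg.IsPAC PairBandit.bernoulliReward δ →
      ENNReal.ofReal
          (min (u 0 * v 0) (1 - u 0 * v 0) / 4 * PairBandit.rate u v * (Real.log (1 / δ) - 1)) ≤
        alg.expectedSamples PairBandit.bernoulliReward u v) := by
  have hmem : u 0 * v 0 ∈ Set.Ioo (0 : ℝ) 1 := ⟨mul_pos (hu 0).1 (hv 0).1,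
    mul_lt_one_of_nonneg_of_lt_one_left (hu 0).1.le (hu 0).2 (hv 0).2.le⟩
  refine ⟨fun F _ hmono husc h =>
    h.rateKL_mul_le_expectedSamples hδ hδ' hmono husc hu hv hu_anti hv_anti, fun h => ?_,
    fun h => ?_⟩
  · have hb := PairBandit.ofReal_mul_rate_mul_log_le hu hv hu_anti hv_anti
      (F := PairBandit.gaussianReward) one_pos (fun p _ => by
        rw [PairBandit.klDiv_gaussianReward, mul_one, ← neg_sub, neg_sq]) hδ hδ'
    rw [one_mul] at hb
    exact hb.trans (h.rateKL_mul_le_expectedSamples hδ hδ'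
      PairBandit.klMonotone_gaussianReward PairBandit.klUpperSemicontinuousRight_gaussianReward
      hu hv hu_anti hv_anti)
  · have hC : 0 < min (u 0 * v 0) (1 - u 0 * v 0) / 4 :=
      div_pos (lt_min hmem.1 (sub_pos.mpr hmem.2)) four_pos
    exact (PairBandit.ofReal_mul_rate_mul_log_le hu hv hu_anti hv_anti hC
      (fun p hp => PairBandit.klDiv_bernoulliReward_le hp hmem) hδ hδ').trans
      (h.rateKL_mul_le_expectedSamples hδ hδ' PairBandit.klMonotone_bernoulliReward
        PairBandit.klUpperSemicontinuousRight_bernoulliReward hu hv hu_anti hv_anti)
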